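/- Let $K$ be a field of characteristic $0$, let $n\ge 0$, let $T=K[x_0,\dots,x_n]$, and let $S=K[y_0,\dots,y_n]$ act on $T$ by differential operators, $y_i\mapsto \partial/\partial x_i$. For a form $F\in T$ let $F^\perp=\{g\in S : g(\partial)F=0\}$. A zero-dimensional closed subscheme $\Gamma\subset\mathbf P^n=\operatorname{Proj} S$ (nonempty and finite over $K$) has degree $\deg\Gamma=\dim_K H^0(\Gamma,\mathcal O_\Gamma)$ and is apolar to $F$ if its homogeneous ideal satisfies $I_\Gamma\subset F^\perp$. It is smoothable if there are an integral locally Noetherian $K$-scheme $B$ with a $K$-rational point $b$ and a closed subscheme $Z\subset\mathbf P^n\times_K B$, finite and flat over $B$, whose fibre over the generic point of $B$ is smooth and whose fibre over $b$ is $\Gamma$. The cactus rank $cr(F)$, the smoothable rank $sr(F)$ and the rank $r(F)$ are the minimal degree of a zero-dimensional closed subscheme $\Gamma\subset\mathbf P^n$ apolar to $F$ that is, respectively, arbitrary, smoothable, and smooth over $K$. Let $F=x_0^{d_0}\cdots x_n^{d_n}$ with integers $0\le d_0\le d_1\le\dots\le d_n$. Then $$F^\perp=(y_0^{d_0+1},\dots,y_n^{d_n+1}),\qquad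 cr(F)=sr(F)=(d_0+1)(d_1+1)\cdots(d_{n-1}+1)$$ (the empty product being $1$). If moreover $d_0=\dots=d_n=d$, then $$r(F)=cr(F)=sr(F)=(d+1)^n.$$ -/

import Mathlib

universe u

open AlgebraicGeometry CategoryTheory CategoryTheory.Limits

noncomputable section

attribute [local instance] MvPolynomial.gradedAlgebra

namespace Apolarity

/-! ### The apolarity action of differential operators and the annihilator of a form -/

section Action

open scoped IsMulCommutative

variable (K : Type u) [Field K] (n : ℕ)

/-- The partial derivatives `∂/∂x_i`, as `K`-linear endomorphisms of `T = K[x_0, …, x_n]`. -/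
def partials : Set (Module.End K (MvPolynomial (Fin (n + 1)) K)) :=
  Set.range fun i => ((MvPolynomial.pderiv i : Derivation K (MvPolynomial (Fin (n + 1)) K)
    (MvPolynomial (Fin (n + 1)) K)) : Module.End K (MvPolynomial (Fin (n + 1)) K))

theorem partials_comm : ∀ a ∈ partials K n, ∀ b ∈ partials K n, a * b = b * a := by
  rintro _ ⟨i, rfl⟩ _ ⟨j, rfl⟩
  let D : Fin (n + 1) → Derivation K (MvPolynomial (Fin (n + 1)) K)
    (MvPolynomial (Fin (n + 1)) K) := fun k => MvPolynomial.pderiv k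
  have h : ⁅D i, D j⁆ = 0 := by
    apply MvPolynomial.derivation_ext
    intro k
    rw [Derivation.commutator_apply]
    simp only [D, MvPolynomial.pderiv_X, Pi.single_apply, Derivation.zero_apply]
    split_ifs <;> simp
  apply LinearMap.ext
  intro f
  have h' : ⁅D i, D j⁆ f = 0 := by rw [h, Derivation.zero_apply]
  rw [Derivation.commutator_apply, sub_eq_zero] at h'
  exact h'

/-- The apolarity action of `S = K[y_0, …, y_n]` on `T = K[x_0, …, x_n]`, as the homomorphism of
`K`-algebras `S → End_K(T)` that sends `y_i` to `∂/∂x_i`. It is evaluation at the partial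
derivatives, inside the commutative algebra of operators which they generate. -/
def action : MvPolynomial (Fin (n + 1)) K →ₐ[K] Module.End K (MvPolynomial (Fin (n + 1)) K) :=
  haveI : IsMulCommutative (Algebra.adjoin K (partials K n)) :=
    Algebra.isMulCommutative_adjoin K (partials_comm K n)
  (Algebra.adjoin K (partials K n)).val.comp
    (MvPolynomial.aeval (R := K) (S₁ := Algebra.adjoin K (partials K n)) fun i =>
      ⟨_, Algebra.subset_adjoin (Set.mem_range_self i)⟩)

theorem action_X (i : Fin (n + 1)) (f : MvPolynomial (Fin (n + 1)) K) :
    action K n (MvPolynomial.X i) f = MvPolynomial.pderiv i f := by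
  simp [action]

variable {K n}

/-- `F^⊥ ⊆ S`, the ideal of all differential operators that annihilate `F`. -/
def annihilator (F : MvPolynomial (Fin (n + 1)) K) : Ideal (MvPolynomial (Fin (n + 1)) K) where
  carrier := {g | action K n g F = 0}
  zero_mem' := by simp
  add_mem' {a b} ha hb := by
    simp only [Set.mem_ofPred_eq] at ha hb ⊢
    simp [ha, hb]
  smul_mem' c g hg := by
    simp only [Set.mem_ofPred_eq] at hg ⊢
    simp [hg]

end Action

/-! ### Finite subschemes of projective space -/

variable (K : Type u) [Field K] (n : ℕ)

/-- Projective `n`-space over `K`, as `Proj` of `S = K[y_0, …, y_n]` with the standard grading. -/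
abbrev projSpace : Scheme.{u} :=
  Proj (MvPolynomial.homogeneousSubmodule (Fin (n + 1)) K)

/-- The structure morphism of projective space over `K`. -/
def projSpaceToSpec : projSpace K n ⟶ Spec (.of K) :=
  Proj.toSpecZero (MvPolynomial.homogeneousSubmodule (Fin (n + 1)) K) ≫
    Spec.map (CommRingCat.ofHom
      (algebraMap K (MvPolynomial.homogeneousSubmodule (Fin (n + 1)) K 0)))

/-- A zero-dimensional closed subscheme `Γ` of projective `n`-space over `K`: closed, nonempty, and
finite over `K`. -/
structure FiniteSubscheme where
  carrier : Scheme.{u}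
  ι : carrier ⟶ projSpace K n
  isClosedImmersion : IsClosedImmersion ι
  isFinite : IsFinite (ι ≫ projSpaceToSpec K n)
  nonempty : Nonempty carrier

namespace FiniteSubscheme

variable {K n} (Γ : FiniteSubscheme K n)

/-- The structure morphism `Γ ⟶ Spec K`. -/
def toSpec : Γ.carrier ⟶ Spec (.of K) :=
  Γ.ι ≫ projSpaceToSpec K n

/-- The degree (length) of `Γ`: the dimension over `K` of its ring of global functions. -/
def degree : ℕ :=
  letI : Algebra K Γ(Γ.carrier, ⊤) :=
    ((Scheme.ΓSpecIso (.of K)).inv ≫ Γ.toSpec.appTop).hom.toAlgebra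
  Module.finrank K Γ(Γ.carrier, ⊤)

/-- A form `f` of degree `m` vanishes on `Γ` if, for every `i`, the function `f / y_i ^ m` on the
chart `y_i ≠ 0` restricts to zero on `Γ`. -/
def Vanishes (m : ℕ) (f : MvPolynomial (Fin (n + 1)) K)
    (hf : f ∈ MvPolynomial.homogeneousSubmodule (Fin (n + 1)) K (m • 1)) : Prop :=
  ∀ i : Fin (n + 1),
    Γ.ι.app (Proj.basicOpen (MvPolynomial.homogeneousSubmodule (Fin (n + 1)) K)
        (MvPolynomial.X i))
      (Proj.awayToSection (MvPolynomial.homogeneousSubmodule (Fin (n + 1)) K) (MvPolynomial.X i)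
        (HomogeneousLocalization.Away.mk (MvPolynomial.homogeneousSubmodule (Fin (n + 1)) K)
          (MvPolynomial.isHomogeneous_X K i) m f hf)) = 0

/-- The homogeneous ideal `I_Γ ⊆ S`, generated by all forms that vanish on `Γ`. -/
def ideal : Ideal (MvPolynomial (Fin (n + 1)) K) :=
  Ideal.span {f | ∃ (m : ℕ) (hf : f ∈ MvPolynomial.homogeneousSubmodule (Fin (n + 1)) K (m • 1)),
    Γ.Vanishes m f hf}

/-- `Γ` is apolar to `F` if `I_Γ ⊆ F^⊥`. -/
def IsApolar (F : MvPolynomial (Fin (n + 1)) K) : Prop :=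
  Γ.ideal ≤ annihilator F

/-- `Γ` is smooth (over `K`). -/
def IsSmooth : Prop :=
  Smooth Γ.toSpec

/-- `Γ` is smoothable: it is a flat limit of smooth finite subschemes of projective space. That is,
there are an integral locally Noetherian `K`-scheme `T` with a `K`-rational point `t`, and a closed
subscheme `Z` of `ℙⁿ × T` that is finite and flat over `T`, such that the fibre of `Z` over the
generic point of `T` is smooth and the fibre over `t` is `Γ`, as a subscheme of `ℙⁿ`. The embedding
of `Z` into `ℙⁿ × T` is given by its two components `q` and `π`. -/
def IsSmoothable : Prop :=
  ∃ (T : Scheme.{u}) (s : T ⟶ Spec (.of K)) (_ : IsIntegral T) (_ : IsLocallyNoetherian T)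
    (t : Spec (.of K) ⟶ T) (_ : t ≫ s = 𝟙 _)
    (Z : Scheme.{u}) (q : Z ⟶ projSpace K n) (π : Z ⟶ T)
    (hqπ : q ≫ projSpaceToSpec K n = π ≫ s),
    IsClosedImmersion (pullback.lift q π hqπ) ∧
    IsFinite π ∧ Flat π ∧
    Smooth (π.fiberToSpecResidueField (genericPoint T)) ∧
    ∃ j : Γ.carrier ⟶ Z, IsPullback j Γ.toSpec π t ∧ j ≫ q = Γ.ι

end FiniteSubscheme

/-! ### The three ranks of a form

The minima are taken in `ℕ∞`; they are `⊤` if there is no subscheme of the required kind. -/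

variable {K n} (F : MvPolynomial (Fin (n + 1)) K)

/-- The cactus rank `cr(F)`: the minimal degree of a finite subscheme apolar to `F`. -/
def cactusRank : ℕ∞ :=
  ⨅ (Γ : FiniteSubscheme K n) (_ : Γ.IsApolar F), (Γ.degree : ℕ∞)

/-- The smoothable rank `sr(F)`: the minimal degree of a smoothable finite subscheme apolar
to `F`. -/
def smoothableRank : ℕ∞ :=
  ⨅ (Γ : FiniteSubscheme K n) (_ : Γ.IsSmoothable ∧ Γ.IsApolar F), (Γ.degree : ℕ∞)

/-- The rank `r(F)`: the minimal degree of a smooth finite subscheme apolar to `F`. -/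
def rank : ℕ∞ :=
  ⨅ (Γ : FiniteSubscheme K n) (_ : Γ.IsSmooth ∧ Γ.IsApolar F), (Γ.degree : ℕ∞)

end Apolarity

end

noncomputable section

attribute [local instance] MvPolynomial.gradedAlgebra

/-! ### The annihilator of a monomial -/

namespace Apolarity

variable {K : Type u} [Field K] {n : ℕ}

/-! Differentiating a monomial gives a scalar times a monomial, so in characteristic 0 the ideal
`F^⊥` is spanned by the monomials not dividing `F`.

Lower bound (`prod_le_mul_finrank`, `FiniteSubscheme.prod_le_mul_degree`). Let `Γ` be apolar to `F`,
let `A` be its ring of functions, and dehomogenize by a linear form that vanishes at no point of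
`Γ`. Let `h m` be the dimension of the image in `A` of the forms of degree `m`, and `N m` the number
of monomials of degree `m` dividing `F`. Take `δ = d_n + 1` and a general combination `g` of the
powers `y_i ^ δ`: it lies in `F^⊥` and is a unit on `Γ`. Multiplication by `g` embeds the degree `m`
image into the degree `m + δ` image, inside the part that dies modulo `F^⊥`, so `N (m + δ) + h m ≤ h
(m + δ)`. Summing over `m` and using `h ≤ deg Γ` gives `∏ (d_i + 1) ≤ δ * deg Γ`; the factor `d_n +
1` cancels.

Upper bounds. In the chart `y_n = 1`, the scheme `y_i ^ (d_i + 1) = 0` for `i < n` is apolar to `F`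
and has the required degree. It is the fibre at `t = 0` of the family `∏_{j ≤ d_i} (y_i - j t) = 0`,
which is finite, free and generically smooth (`exists_smoothable_isApolar`). If all exponents equal
`e`, the reduced scheme `y_i ^ (e + 1) = 1` serves instead (`exists_smooth_isApolar`). -/

theorem exists_action_monomial [CharZero K] (α β : Fin (n + 1) →₀ ℕ) :
    ∃ c : K, (c ≠ 0 ↔ α ≤ β) ∧
      action K n (MvPolynomial.monomial α 1) (MvPolynomial.monomial β 1) =
        MvPolynomial.monomial (β - α) c := by
  -- The starting exponent `γ` is left free so that `δ` can be built up one variable at a time. When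
  -- `α ≤ β` fails the scalar is zero, so the truncated `β - α` is harmless.
  suffices H : ∀ δ γ : Fin (n + 1) →₀ ℕ,
      (∃ c : K, (c ≠ 0 ↔ γ ≤ β) ∧ action K n (MvPolynomial.monomial γ 1)
        (MvPolynomial.monomial β 1) = MvPolynomial.monomial (β - γ) c) →
      ∃ c : K, (c ≠ 0 ↔ γ + δ ≤ β) ∧ action K n (MvPolynomial.monomial (γ + δ) 1)
        (MvPolynomial.monomial β 1) = MvPolynomial.monomial (β - (γ + δ)) c by
    simpa using H α 0 ⟨1, by simp, by
      rw [show MvPolynomial.monomial (0 : Fin (n + 1) →₀ ℕ) (1 : K) = 1 from rfl, map_one]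
      simp⟩
  intro δ
  induction δ using Finsupp.induction_linear with
  | zero => simp
  | add f g hf hg =>
    intro γ hγ
    rw [← add_assoc]
    exact hg _ (hf _ hγ)
  | single i k =>
    induction k with
    | zero => simp
    | succ k ih =>
      intro γ hγ
      obtain ⟨c, hc, h⟩ := ih γ hγ
      rw [Finsupp.single_add, ← add_assoc]
      set ε := γ + Finsupp.single i k
      refine ⟨c * ((β - ε) i : ℕ), ?_, ?_⟩
      · rw [mul_ne_zero_iff, hc, Nat.cast_ne_zero, Finsupp.tsub_apply]
        constructor
        · rintro ⟨h1, h2⟩ j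
          rcases eq_or_ne i j with rfl | hij
          · simp only [Finsupp.add_apply, Finsupp.single_eq_same]
            omega
          · simpa [Finsupp.single_eq_of_ne hij.symm] using h1 j
        · intro h1
          refine ⟨le_self_add.trans h1, ?_⟩
          have := h1 i
          simp only [Finsupp.add_apply, Finsupp.single_eq_same] at this
          omega
      · rw [add_comm ε, MvPolynomial.monomial_single_add, pow_one, map_mul,
          Module.End.mul_apply, h, action_X, MvPolynomial.pderiv_monomial,
          ← tsub_add_eq_tsub_tsub, add_comm ε]

theorem action_apply_eq_sum (g f : MvPolynomial (Fin (n + 1)) K) :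
    action K n g f = ∑ α ∈ g.support, g.coeff α • action K n (MvPolynomial.monomial α 1) f := by
  conv_lhs => rw [g.as_sum]
  rw [map_sum, LinearMap.sum_apply]
  refine Finset.sum_congr rfl fun α _ => ?_
  rw [← mul_one (g.coeff α), ← smul_eq_mul, ← MvPolynomial.smul_monomial, map_smul,
    LinearMap.smul_apply]
  simp

/-- The divisors `α ≤ d` give distinct monomials `d - α` with nonzero scalars, so nothing cancels;
all other `α` contribute zero. -/
theorem mem_annihilator_monomial_iff [CharZero K] (d : Fin (n + 1) →₀ ℕ)
    (g : MvPolynomial (Fin (n + 1)) K) :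
    g ∈ annihilator (MvPolynomial.monomial d (1 : K)) ↔ ∀ α ≤ d, g.coeff α = 0 := by
  classical
  choose c hc h using fun α => exists_action_monomial (K := K) α d
  change action K n g _ = 0 ↔ _
  rw [action_apply_eq_sum]
  simp only [h, MvPolynomial.smul_monomial, smul_eq_mul]
  constructor
  · intro H α hα
    by_contra hg
    have := congrArg (MvPolynomial.coeff (d - α)) H
    rw [MvPolynomial.coeff_sum, Finset.sum_eq_single α] at this
    · simp [hg, (hc α).2 hα] at this
    · intro γ _ hγα
      rw [MvPolynomial.coeff_monomial]
      split_ifs with heq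
      · by_cases hγ : γ ≤ d
        · exfalso
          apply hγα
          rw [← tsub_tsub_cancel_of_le hγ, heq, tsub_tsub_cancel_of_le hα]
        · rw [not_ne_iff.1 ((hc γ).not.2 hγ), mul_zero]
      · rfl
    · simp +contextual
  · intro H
    refine Finset.sum_eq_zero fun α _ => ?_
    by_cases hα : α ≤ d
    · simp [H α hα]
    · simp [not_ne_iff.1 ((hc α).not.2 hα)]

theorem prod_X_pow_eq_monomial_equivFunOnFinite (d : Fin (n + 1) → ℕ) :
    ∏ i, (MvPolynomial.X i : MvPolynomial (Fin (n + 1)) K) ^ d i =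
      MvPolynomial.monomial (Finsupp.equivFunOnFinite.symm d) 1 := by
  rw [MvPolynomial.monomial_eq, Finsupp.prod_fintype _ _ (by simp)]
  simp

theorem mem_span_X_pow_iff {σ : Type*} (e : σ → ℕ) (g : MvPolynomial σ K) :
    g ∈ Ideal.span (Set.range fun i => (MvPolynomial.X i : MvPolynomial σ K) ^ e i) ↔
      ∀ α, (∀ i, α i < e i) → g.coeff α = 0 := by
  have : (Set.range fun i => (MvPolynomial.X i : MvPolynomial σ K) ^ e i) =
      (fun s => MvPolynomial.monomial s (1 : K)) '' Set.range fun i => Finsupp.single i (e i) := by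
    rw [← Set.range_comp]
    congr 1
    ext1 i
    simp [MvPolynomial.X_pow_eq_monomial]
  rw [this, MvPolynomial.mem_ideal_span_monomial_image]
  constructor
  · intro H α hα
    by_contra hg
    obtain ⟨_, ⟨i, rfl⟩, hi⟩ := H α (MvPolynomial.mem_support_iff.2 hg)
    exact (hα i).not_ge (by simpa using hi i)
  · intro H α hα
    by_contra! hg
    refine MvPolynomial.mem_support_iff.1 hα (H α fun i => ?_)
    by_contra! hi
    exact hg _ ⟨i, rfl⟩ (by simpa using hi)

theorem annihilator_prod_X_pow [CharZero K] (d : Fin (n + 1) → ℕ) :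
    annihilator (∏ i, (MvPolynomial.X i : MvPolynomial (Fin (n + 1)) K) ^ d i) =
      Ideal.span (Set.range fun i : Fin (n + 1) =>
          (MvPolynomial.X i ^ (d i + 1) : MvPolynomial (Fin (n + 1)) K)) := by
  ext g
  rw [prod_X_pow_eq_monomial_equivFunOnFinite, mem_annihilator_monomial_iff,
    mem_span_X_pow_iff (fun i => d i + 1)]
  simp only [Nat.lt_succ_iff]
  rfl

theorem mem_annihilator_prod_iff [CharZero K] (d : Fin (n + 1) → ℕ)
    (g : MvPolynomial (Fin (n + 1)) K) :
    g ∈ annihilator (∏ i, (MvPolynomial.X i : MvPolynomial (Fin (n + 1)) K) ^ d i) ↔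
      ∀ α : Fin (n + 1) →₀ ℕ, (∀ i, α i ≤ d i) → g.coeff α = 0 := by
  rw [prod_X_pow_eq_monomial_equivFunOnFinite, mem_annihilator_monomial_iff]
  rfl

end Apolarity

/-! ### Hilbert function estimate and general position -/

namespace Apolarity

variable {K : Type u} [Field K] {n : ℕ}

/-- Since `ker L ≤ ker E`, the map `E` descends to a surjection from the range of `L`, whose kernel
contains the range of `L ∘ M`; rank-nullity concludes. In the application `L` restricts forms to
`Γ`, `E` reduces them modulo `F^⊥`, and `M` multiplies by `g`. -/
theorem finrank_add_finrank_range_le {V A B V' : Type*} [AddCommGroup V] [Module K V]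
    [AddCommGroup A] [Module K A] [AddCommGroup B] [Module K B] [AddCommGroup V'] [Module K V']
    [Module.Finite K A] (L : V →ₗ[K] A) (E : V →ₗ[K] B) (hE : Function.Surjective E)
    (hLE : LinearMap.ker L ≤ LinearMap.ker E) (M : V' →ₗ[K] V) (hM : E ∘ₗ M = 0) :
    Module.finrank K B + Module.finrank K (LinearMap.range (L ∘ₗ M)) ≤
      Module.finrank K (LinearMap.range L) := by
  let E' : LinearMap.range L →ₗ[K] B :=
    (LinearMap.ker L).liftQ E hLE ∘ₗ L.quotKerEquivRange.symm.toLinearMap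
  have hE' : ∀ v, E' ⟨L v, v, rfl⟩ = E v := by
    intro v
    have : L.quotKerEquivRange.symm ⟨L v, v, rfl⟩ = Submodule.Quotient.mk v := by
      rw [LinearEquiv.symm_apply_eq]
      rfl
    simp [E', this]
  have hsurj : LinearMap.range E' = ⊤ := by
    rw [LinearMap.range_eq_top]
    intro b
    obtain ⟨v, rfl⟩ := hE b
    exact ⟨_, hE' v⟩
  rw [← LinearMap.finrank_range_add_finrank_ker E', hsurj, finrank_top]
  refine Nat.add_le_add_left ?_ _
  let j : LinearMap.range (L ∘ₗ M) →ₗ[K] LinearMap.ker E' :=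
    LinearMap.codRestrict _ (LinearMap.codRestrict _ (Submodule.subtype _) (by
      rintro ⟨_, w, rfl⟩
      exact ⟨M w, rfl⟩)) (by
      rintro ⟨_, w, rfl⟩
      exact (hE' (M w)).trans (LinearMap.congr_fun hM w))
  refine LinearMap.finrank_le_finrank_of_injective (f := j) ?_
  intro x y h
  have h' : ((j x : LinearMap.range L) : A) = (j y : LinearMap.range L) := by rw [h]
  exact Subtype.ext h'

/-- The inequalities telescope with step `δ`, leaving only the top `δ` values of `h`, each at most
`r`. -/
theorem sum_range_le_mul_of_shift {N h : ℕ → ℕ} {δ r : ℕ} (hN : ∀ m, N m ≤ h m)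
    (hNh : ∀ m, N (m + δ) + h m ≤ h (m + δ)) (hr : ∀ m, h m ≤ r) (M : ℕ) :
    ∑ m ∈ Finset.range (M + δ), N m ≤ δ * r := by
  have h1 : ∑ m ∈ Finset.range (M + δ), N m + ∑ m ∈ Finset.range M, h m ≤
      ∑ m ∈ Finset.range (M + δ), h m := by
    induction M with
    | zero => simpa using Finset.sum_le_sum fun i _ => hN i
    | succ M ih =>
      rw [Nat.add_right_comm, Finset.sum_range_succ, Finset.sum_range_succ,
        Finset.sum_range_succ (n := M + δ)]
      linarith [hNh M]
  have h2 : ∑ m ∈ Finset.range (M + δ), h m ≤ ∑ m ∈ Finset.range M, h m + δ * r := by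
    rw [Finset.sum_range_add]
    refine Nat.add_le_add_left ?_ _
    simpa using Finset.sum_le_card_nsmul (Finset.range δ) (fun x => h (M + x)) r fun i _ => hr _
  omega

theorem prod_le_mul_finrank {A : Type*} [CommRing A] [Algebra K A] [Module.Finite K A]
    (φ : MvPolynomial (Fin (n + 1)) K →ₐ[K] A) (d : Fin (n + 1) →₀ ℕ)
    (hφ : ∀ m f, MvPolynomial.IsHomogeneous f m → φ f = 0 → ∀ α ≤ d, f.coeff α = 0)
    (δ : ℕ) (g : MvPolynomial (Fin (n + 1)) K) (hg : g.IsHomogeneous δ) (hgu : IsUnit (φ g))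
    (hgd : ∀ f, ∀ α ≤ d, (g * f).coeff α = 0) :
    ∏ i, (d i + 1) ≤ δ * Module.finrank K A := by
  classical
  let V (m : ℕ) := MvPolynomial.homogeneousSubmodule (Fin (n + 1)) K m
  let L (m : ℕ) : V m →ₗ[K] A := φ.toLinearMap ∘ₗ (V m).subtype
  let box (m : ℕ) := (Finset.Iic d).filter fun α => α.degree = m
  let E (m : ℕ) : V m →ₗ[K] (box m → K) :=
    LinearMap.pi fun α => MvPolynomial.lcoeff K α.1 ∘ₗ (V m).subtype
  have hE : ∀ m, Function.Surjective (E m) := by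
    intro m c
    refine ⟨⟨∑ α : box m, MvPolynomial.monomial α.1 (c α), ?_⟩, ?_⟩
    · refine Submodule.sum_mem _ fun α _ => ?_
      exact MvPolynomial.isHomogeneous_monomial _ (Finset.mem_filter.1 α.2).2
    · ext β
      simp only [E, LinearMap.pi_apply, LinearMap.comp_apply, Submodule.subtype_apply,
        MvPolynomial.lcoeff_apply, MvPolynomial.coeff_sum, MvPolynomial.coeff_monomial]
      rw [Finset.sum_eq_single β]
      · simp
      · intro α _ h
        rw [if_neg fun h' => h (Subtype.ext h')]
      · simp
  have hLE : ∀ m, LinearMap.ker (L m) ≤ LinearMap.ker (E m) := by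
    rintro m ⟨f, hf⟩ h
    rw [LinearMap.mem_ker] at h ⊢
    ext α
    exact hφ m f hf h _ (Finset.mem_Iic.1 (Finset.mem_filter.1 α.2).1)
  let M (m : ℕ) : V m →ₗ[K] V (m + δ) :=
    LinearMap.codRestrict _ (LinearMap.mulLeft K g ∘ₗ (V m).subtype) fun f => by
      rw [add_comm m δ]
      exact hg.mul f.2
  have hM : ∀ m, E (m + δ) ∘ₗ M m = 0 := by
    intro m
    ext f α
    exact hgd _ _ (Finset.mem_Iic.1 (Finset.mem_filter.1 α.2).1)
  have hcard : ∀ m, Module.finrank K (box m → K) = (box m).card := fun m => by simp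
  have hinj : Function.Injective (LinearMap.mulLeft K (φ g)) := hgu.mul_right_injective
  have hrange : ∀ m, Module.finrank K (LinearMap.range (L (m + δ) ∘ₗ M m)) =
      Module.finrank K (LinearMap.range (L m)) := by
    intro m
    have : L (m + δ) ∘ₗ M m = LinearMap.mulLeft K (φ g) ∘ₗ L m := by
      ext f
      exact map_mul φ g f
    rw [this, LinearMap.range_comp]
    exact (Submodule.equivMapOfInjective _ hinj _).finrank_eq.symm
  have key := sum_range_le_mul_of_shift (N := fun m => (box m).card)
    (h := fun m => Module.finrank K (LinearMap.range (L m))) (δ := δ) (r := Module.finrank K A)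
    (fun m => by
      -- With zero in place of multiplication by `g` the inequality reduces to `N m ≤ h m`, which
      -- starts the telescoping.
      have := finrank_add_finrank_range_le (L m) (E m) (hE m) (hLE m) (0 : K →ₗ[K] V m) (by simp)
      rw [hcard] at this
      exact (Nat.le_add_right _ _).trans this)
    (fun m => by
      have := finrank_add_finrank_range_le (L (m + δ)) (E _) (hE _) (hLE _) (M m) (hM m)
      rwa [hcard, hrange] at this)
    -- Degrees up to `d.degree` already exhaust all `α ≤ d`.
    (fun m => Submodule.finrank_le _) (d.degree + 1)
  refine le_trans (le_of_eq ?_) key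
  have h1 : ∏ i, (d i + 1) = (Finset.Iic d).card := by
    rw [Finsupp.card_Iic]
    simp only [Nat.card_Iic]
    refine (Finset.prod_subset (Finset.subset_univ _) fun i _ hi => ?_).symm
    simpa using hi
  rw [h1]
  refine Finset.card_eq_sum_card_fiberwise fun α hα => ?_
  have : α.degree ≤ d.degree := by
    rw [Finsupp.degree_eq_sum, Finsupp.degree_eq_sum]
    exact Finset.sum_le_sum fun i _ => Finset.mem_Iic.1 hα i
  simp only [Finset.coe_range, Set.mem_Iio]
  omega

/-- A vector space over an infinite field is not a finite union of proper subspaces. This supplies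
both the linear form missing the points of `Γ` and the unit `g`. -/
theorem exists_sum_smul_notMem {ι κ R : Type*} [Fintype ι] [Finite κ] [Infinite K]
    [CommRing R] [Algebra K R] (v : ι → R) (P : κ → Ideal R) (h : ∀ x, ∃ i, v i ∉ P x) :
    ∃ c : ι → K, ∀ x, ∑ i, c i • v i ∉ P x := by
  classical
  let f : (ι → K) →ₗ[K] R := Fintype.linearCombination K v
  let W (x : κ) : Submodule K (ι → K) := ((P x).restrictScalars K).comap f
  have hW : ∀ x, W x ≠ ⊤ := by
    intro x hx
    obtain ⟨i, hi⟩ := h x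
    have : Pi.single i 1 ∈ W x := hx ▸ Submodule.mem_top
    apply hi
    simpa [W, f, Fintype.linearCombination_apply_single] using this
  by_contra! H
  have hU : ⋃ x, (W x : Set (ι → K)) = Set.univ := by
    rw [Set.eq_univ_iff_forall]
    intro c
    obtain ⟨x, hx⟩ := H c
    exact Set.mem_iUnion.2 ⟨x, by simpa [W, f, Fintype.linearCombination_apply] using hx⟩
  obtain ⟨x, hx⟩ := Subspace.exists_eq_top_of_iUnion_eq_univ hU
  exact hW x hx

end Apolarity

/-! ### Algebras generated by roots of given polynomials -/

namespace Apolarity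

open scoped TensorProduct Polynomial

/-- Two lifts through a square-zero ideal send each generator to roots of a separable polynomial
that differ by a nilpotent; Newton uniqueness at a simple root makes them equal. -/
theorem formallyUnramified_of_adjoin_eq_top {R : Type*} {B : Type u} [CommRing R] [CommRing B]
    [Algebra R B] {ι : Type*} (b : ι → B) (hb : Algebra.adjoin R (Set.range b) = ⊤) (p : ι → R[X])
    (hp : ∀ i, (p i).Separable) (hpb : ∀ i, Polynomial.aeval (b i) (p i) = 0) :
    Algebra.FormallyUnramified R B := by
  rw [Algebra.FormallyUnramified.iff_comp_injective]
  intro C _ _ I hI f₁ f₂ h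
  refine AlgHom.ext_of_adjoin_eq_top hb ?_
  rintro _ ⟨i, rfl⟩
  have h1 : Polynomial.aeval (f₁ (b i)) (p i) = 0 := by
    rw [Polynomial.aeval_algHom_apply, hpb, map_zero]
  have h2 : Polynomial.aeval (f₂ (b i)) (p i) = 0 := by
    rw [Polynomial.aeval_algHom_apply, hpb, map_zero]
  have hu : IsUnit (Polynomial.aeval (f₁ (b i)) (p i).derivative) := by
    obtain ⟨u, v, huv⟩ := hp i
    have := congrArg (Polynomial.aeval (f₁ (b i))) huv
    rw [map_add, map_mul, map_mul, h1, mul_zero, zero_add, map_one] at this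
    exact IsUnit.of_mul_eq_one_right _ this
  refine (Polynomial.existsUnique_nilpotent_sub_and_aeval_eq_zero
    (by rw [h1]; exact IsNilpotent.zero) hu).unique ⟨by simp, h1⟩ ⟨⟨2, ?_⟩, h2⟩
  have hmem : f₁ (b i) - f₂ (b i) ∈ I := Ideal.Quotient.eq.1 (AlgHom.congr_fun h (b i))
  have : (f₁ (b i) - f₂ (b i)) ^ 2 ∈ I ^ 2 := Ideal.pow_mem_pow hmem 2
  rwa [hI, Ideal.mem_bot] at this

theorem smooth_of_adjoin_eq_top {k : Type*} {B : Type u} [Field k] [CommRing B]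
    [Algebra k B] [Module.Finite k B] {ι : Type*} (b : ι → B)
    (hb : Algebra.adjoin k (Set.range b) = ⊤) (p : ι → k[X])
    (hp : ∀ i, (p i).Separable) (hpb : ∀ i, Polynomial.aeval (b i) (p i) = 0) :
    Algebra.Smooth k B := by
  have := formallyUnramified_of_adjoin_eq_top b hb p hp hpb
  have := Algebra.FormallyEtale.of_formallyUnramified_of_field k B
  have : Algebra.FinitePresentation k B := Algebra.FinitePresentation.of_finiteType.1 inferInstance
  exact ⟨inferInstance, inferInstance⟩

/-- The algebra is the iterated tensor product of the `AdjoinRoot (p i)`, that is `R[y] /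
(p_i(y_i))`. It is used over `K` for the smooth scheme and over `K[t]` for the degeneration. -/
theorem exists_free_algebra_adjoin_roots (R : Type u) [CommRing R] [Nontrivial R] {n : ℕ}
    (p : Fin n → R[X]) (hp : ∀ i, (p i).Monic) :
    ∃ (A : Type u) (_ : CommRing A) (_ : Algebra R A) (a : Fin n → A),
      Module.Free R A ∧ Module.Finite R A ∧
      Module.finrank R A = ∏ i, (p i).natDegree ∧
      Algebra.adjoin R (Set.range a) = ⊤ ∧
      (∀ i, Polynomial.aeval (a i) (p i) = 0) ∧
      ∀ (C : Type u) [CommRing C] [Algebra R C] (c : Fin n → C),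
        (∀ i, Polynomial.aeval (c i) (p i) = 0) → ∃ f : A →ₐ[R] C, ∀ i, f (a i) = c i := by
  induction n with
  | zero =>
    refine ⟨R, inferInstance, inferInstance, Fin.elim0, inferInstance, inferInstance, by simp,
      ?_, fun i => i.elim0, fun C _ _ c _ => ⟨Algebra.ofId R C, fun i => i.elim0⟩⟩
    rw [eq_top_iff]
    intro x _
    exact Subalgebra.algebraMap_mem _ x
  | succ n ih =>
    obtain ⟨A, _, _, a, hfree, hfin, hrank, hadj, hroot, hlift⟩ :=
      ih (fun i => p i.succ) fun i => hp _
    have := (hp 0).free_adjoinRoot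
    have := (hp 0).finite_adjoinRoot
    refine ⟨AdjoinRoot (p 0) ⊗[R] A, inferInstance, inferInstance,
      Fin.cons (AdjoinRoot.root (p 0) ⊗ₜ 1) fun i => 1 ⊗ₜ a i, inferInstance, inferInstance,
      ?_, ?_, ?_, ?_⟩
    · rw [Module.finrank_tensorProduct, hrank, Fin.prod_univ_succ,
        (AdjoinRoot.powerBasis' (hp 0)).finrank, AdjoinRoot.powerBasis'_dim]
    · rw [eq_top_iff]
      rintro x -
      set S := Algebra.adjoin R (Set.range (Fin.cons (α := fun _ => AdjoinRoot (p 0) ⊗[R] A)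
        (AdjoinRoot.root (p 0) ⊗ₜ[R] (1 : A)) fun i => (1 : AdjoinRoot (p 0)) ⊗ₜ[R] a i))
      have h1 : (⊤ : Subalgebra R (AdjoinRoot (p 0))).map
          (Algebra.TensorProduct.includeLeft : _ →ₐ[R] AdjoinRoot (p 0) ⊗[R] A) ≤ S := by
        rw [← AdjoinRoot.adjoinRoot_eq_top, AlgHom.map_adjoin]
        refine Algebra.adjoin_mono ?_
        rintro _ ⟨_, rfl, rfl⟩
        exact ⟨0, rfl⟩
      have h2 : (⊤ : Subalgebra R A).map
          (Algebra.TensorProduct.includeRight : _ →ₐ[R] AdjoinRoot (p 0) ⊗[R] A) ≤ S := by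
        rw [← hadj, AlgHom.map_adjoin]
        refine Algebra.adjoin_mono ?_
        rintro _ ⟨_, ⟨i, rfl⟩, rfl⟩
        exact ⟨i.succ, rfl⟩
      induction x with
      | zero => exact zero_mem S
      | add x y hx hy => exact add_mem hx hy
      | tmul x y =>
        have : x ⊗ₜ[R] y = (x ⊗ₜ[R] (1 : A)) * ((1 : AdjoinRoot (p 0)) ⊗ₜ[R] y) := by simp
        rw [this]
        exact mul_mem (h1 ⟨x, trivial, rfl⟩) (h2 ⟨y, trivial, rfl⟩)
    · intro i
      refine Fin.cases ?_ (fun i => ?_) i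
      · have h := Polynomial.aeval_algHom_apply (Algebra.TensorProduct.includeLeft :
          _ →ₐ[R] AdjoinRoot (p 0) ⊗[R] A) (AdjoinRoot.root (p 0)) (p 0)
        rw [AdjoinRoot.aeval_eq, AdjoinRoot.mk_self, map_zero] at h
        exact h
      · have h := Polynomial.aeval_algHom_apply (Algebra.TensorProduct.includeRight :
          _ →ₐ[R] AdjoinRoot (p 0) ⊗[R] A) (a i) (p i.succ)
        rw [hroot, map_zero] at h
        exact h
    · intro C _ _ c hc
      obtain ⟨f, hf⟩ := hlift C (fun i => c i.succ) fun i => hc _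
      refine ⟨Algebra.TensorProduct.lift (AdjoinRoot.liftAlgHom (p 0) (Algebra.ofId R C) (c 0)
        (hc 0)) f fun _ _ => mul_comm _ _, fun i => ?_⟩
      refine Fin.cases ?_ (fun i => ?_) i
      · refine (Algebra.TensorProduct.lift_tmul _ _ _ _ _).trans ?_
        rw [map_one, mul_one]
        exact AdjoinRoot.lift_root (hc 0)
      · refine (Algebra.TensorProduct.lift_tmul _ _ _ _ _).trans ?_
        simp [hf]

end Apolarity

/-! ### Functions on the charts of Proj -/

namespace Apolarity

variable (K : Type u) [Field K] (n : ℕ)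

instance : IsSeparated (projSpaceToSpec K n) := by
  unfold projSpaceToSpec
  infer_instance

theorem awayToSection_awayι_appLE {A : Type u} {σ : Type*} [CommRing A] [SetLike σ A]
    [AddSubgroupClass σ A] (𝒜 : ℕ → σ) [GradedRing 𝒜] {f : A} {m : ℕ} (hf : f ∈ 𝒜 m) (hm : 0 < m)
    (h : ⊤ ≤ Proj.awayι 𝒜 f hf hm ⁻¹ᵁ Proj.basicOpen 𝒜 f) :
    Proj.awayToSection 𝒜 f ≫ (Proj.awayι 𝒜 f hf hm).appLE (Proj.basicOpen 𝒜 f) ⊤ h =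
      (Scheme.ΓSpecIso _).inv := by
  have h1 : (Proj.awayι 𝒜 f hf hm).appLE (Proj.basicOpen 𝒜 f) ⊤ h =
      (Proj.basicOpen 𝒜 f).topIso.inv ≫ (Proj.basicOpenIsoSpec 𝒜 f hf hm).inv.appTop := by
    have e : ⊤ ≤ (Proj.basicOpen 𝒜 f).ι ⁻¹ᵁ Proj.basicOpen 𝒜 f := by simp
    refine (Scheme.Hom.appLE_comp_appLE _ _ _ ⊤ ⊤ e le_top).symm.trans ?_
    congr 1
  have h2 : (Proj.basicOpenToSpec 𝒜 f).appTop = (Scheme.ΓSpecIso _).hom ≫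
      Proj.awayToSection 𝒜 f ≫ (Proj.basicOpen 𝒜 f).topIso.inv :=
    Proj.basicOpenToSpec_app_top 𝒜 f
  have h3 : (Proj.basicOpenIsoSpec 𝒜 f hf hm).hom.appTop ≫
    (Proj.basicOpenIsoSpec 𝒜 f hf hm).inv.appTop = 𝟙 _ := by
    rw [← Scheme.Hom.comp_appTop, Iso.inv_hom_id, Scheme.Hom.id_appTop]
  rw [h1, ← cancel_epi (Scheme.ΓSpecIso _).hom, Iso.hom_inv_id, ← h3, Proj.basicOpenIsoSpec_hom]
  rw [h2, Category.assoc, Category.assoc]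

theorem awayToSection_comp_appLE_of_comp_awayι {A : Type u} {σ : Type*} [CommRing A] [SetLike σ A]
    [AddSubgroupClass σ A] (𝒜 : ℕ → σ) [GradedRing 𝒜] {f : A} {m : ℕ} (hf : f ∈ 𝒜 m) (hm : 0 < m)
    {W : Scheme.{u}} (g : W ⟶ Proj 𝒜) (k : W ⟶ Spec (.of (HomogeneousLocalization.Away 𝒜 f)))
    (hk : k ≫ Proj.awayι 𝒜 f hf hm = g) (h : ⊤ ≤ g ⁻¹ᵁ Proj.basicOpen 𝒜 f) :
    Proj.awayToSection 𝒜 f ≫ g.appLE (Proj.basicOpen 𝒜 f) ⊤ h =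
      (Scheme.ΓSpecIso _).inv ≫ k.appTop := by
  subst hk
  have h' : ⊤ ≤ Proj.awayι 𝒜 f hf hm ⁻¹ᵁ Proj.basicOpen 𝒜 f := by
    rw [← Proj.opensRange_awayι 𝒜 f hf hm]
    intro x _
    exact ⟨x, rfl⟩
  rw [← awayToSection_awayι_appLE 𝒜 hf hm h', Category.assoc]
  congr 1
  rw [← Scheme.Hom.appLE_comp_appLE _ _ _ ⊤ ⊤ h' le_top]
  congr 1
  exact (Scheme.Hom.app_eq_appLE _).symm

end Apolarity

/-! ### Maps from affine schemes to the chart `y_n ≠ 0` -/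

namespace Apolarity

variable {K : Type u} [Field K] {n : ℕ}

theorem X_mem_homogeneousSubmodule (i : Fin (n + 1)) :
    (MvPolynomial.X i : MvPolynomial (Fin (n + 1)) K) ∈
      MvPolynomial.homogeneousSubmodule (Fin (n + 1)) K 1 :=
  MvPolynomial.isHomogeneous_X K i

theorem C_mem_homogeneousSubmodule (c : K) :
    (MvPolynomial.C c : MvPolynomial (Fin (n + 1)) K) ∈
      MvPolynomial.homogeneousSubmodule (Fin (n + 1)) K (0 • 1) :=
  MvPolynomial.isHomogeneous_C _ c

theorem fromZeroRingHom_algebraMap {l : MvPolynomial (Fin (n + 1)) K}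
    (hl : l ∈ MvPolynomial.homogeneousSubmodule (Fin (n + 1)) K 1) (c : K) :
    HomogeneousLocalization.fromZeroRingHom (MvPolynomial.homogeneousSubmodule (Fin (n + 1)) K)
      (Submonoid.powers l)
      (algebraMap K (MvPolynomial.homogeneousSubmodule (Fin (n + 1)) K 0) c) =
      HomogeneousLocalization.Away.mk _ hl 0 (MvPolynomial.C c) (C_mem_homogeneousSubmodule c) := by
  apply HomogeneousLocalization.val_injective
  rw [HomogeneousLocalization.Away.val_mk]
  simp only [pow_zero]
  rfl

/-- Dehomogenization: `f / y_n ^ m` goes to `f(a, 1)`. -/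
def chartHom {A : Type u} [CommRing A] [Algebra K A] (a : Fin n → A) :
    HomogeneousLocalization.Away (MvPolynomial.homogeneousSubmodule (Fin (n + 1)) K)
      (MvPolynomial.X (Fin.last n)) →+* A :=
  (Localization.awayLift
    (MvPolynomial.aeval (Fin.snoc a 1) : MvPolynomial (Fin (n + 1)) K →ₐ[K] A).toRingHom
    (MvPolynomial.X (Fin.last n)) (by simp)).comp
  (algebraMap _ (Localization.Away (MvPolynomial.X (Fin.last n))))

theorem chartHom_mk {A : Type u} [CommRing A] [Algebra K A] (a : Fin n → A) (m : ℕ)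
    (f : MvPolynomial (Fin (n + 1)) K)
    (hf : f ∈ MvPolynomial.homogeneousSubmodule (Fin (n + 1)) K (m • 1)) :
    chartHom a (HomogeneousLocalization.Away.mk
      (MvPolynomial.homogeneousSubmodule (Fin (n + 1)) K)
      (X_mem_homogeneousSubmodule (Fin.last n)) m f hf) =
      MvPolynomial.aeval (Fin.snoc a 1 : Fin (n + 1) → A) f := by
  simp only [chartHom, RingHom.comp_apply, HomogeneousLocalization.algebraMap_apply,
    HomogeneousLocalization.Away.val_mk]
  rw [Localization.awayLift_mk (v := (1 : A)) (hv := by simp)]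
  simp

theorem chartHom_fromZero {A : Type u} [CommRing A] [Algebra K A] (a : Fin n → A) (c : K) :
    chartHom a (HomogeneousLocalization.fromZeroRingHom _ _ (algebraMap K
      (MvPolynomial.homogeneousSubmodule (Fin (n + 1)) K 0) c)) = algebraMap K A c := by
  rw [fromZeroRingHom_algebraMap (X_mem_homogeneousSubmodule _), chartHom_mk]
  simp

/-- The `A`-valued point `[a_0 : … : a_{n-1} : 1]`. -/
def toProj {A : Type u} [CommRing A] [Algebra K A] (a : Fin n → A) :
    Spec (.of A) ⟶ projSpace K n :=
  Spec.map (CommRingCat.ofHom (chartHom a)) ≫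
    Proj.awayι _ (MvPolynomial.X (Fin.last n)) (X_mem_homogeneousSubmodule (Fin.last n))
      one_pos

theorem toProj_projSpaceToSpec {A : Type u} [CommRing A] [Algebra K A] (a : Fin n → A) :
    toProj a ≫ projSpaceToSpec K n = Spec.map (CommRingCat.ofHom (algebraMap K A)) := by
  unfold toProj projSpaceToSpec
  rw [Category.assoc, Proj.awayι_toSpecZero_assoc, ← Spec.map_comp, ← Spec.map_comp]
  congr 1
  ext c
  exact chartHom_fromZero a c

theorem specMap_toProj {A B : Type u} [CommRing A] [Algebra K A] [CommRing B] [Algebra K B]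
    (f : A →+* B) (hf : f.comp (algebraMap K A) = algebraMap K B) (a : Fin n → A) (b : Fin n → B)
    (hab : ∀ i, f (a i) = b i) :
    Spec.map (CommRingCat.ofHom f) ≫ toProj a = toProj (K := K) b := by
  unfold toProj
  rw [← Category.assoc, ← Spec.map_comp]
  congr 2
  ext x
  obtain ⟨m, g, hg, rfl⟩ := HomogeneousLocalization.Away.mk_surjective
    (MvPolynomial.homogeneousSubmodule (Fin (n + 1)) K)
    (X_mem_homogeneousSubmodule (Fin.last n)) x
  change f (chartHom a _) = chartHom b _
  rw [chartHom_mk, chartHom_mk, MvPolynomial.aeval_def, MvPolynomial.aeval_def,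
    MvPolynomial.hom_eval₂, hf]
  congr 1
  ext i
  refine Fin.lastCases ?_ (fun i => ?_) i
  · simp
  · simp [hab]

/-- A map to `Spec A` is determined by the pullbacks of `R` and of the generators `a i`, and `a i`
is the pullback of the chart function `y_i / y_n`. A general base `R` is kept so that the result
also covers families. -/
theorem eq_of_comp_toProj_eq {R A : Type u} [CommRing R] [CommRing A] [Algebra K A] [Algebra R A]
    (a : Fin n → A) (ha : Algebra.adjoin R (Set.range a) = ⊤) {W : Scheme.{u}}
    (u v : W ⟶ Spec (.of A)) (h : u ≫ toProj (K := K) a = v ≫ toProj a)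
    (h' : u ≫ Spec.map (CommRingCat.ofHom (algebraMap R A)) =
      v ≫ Spec.map (CommRingCat.ofHom (algebraMap R A))) : u = v := by
  have key : ∀ {B : Type u} [CommRing B] (ψ : B →+* A),
      u ≫ Spec.map (CommRingCat.ofHom ψ) = v ≫ Spec.map (CommRingCat.ofHom ψ) → ∀ x,
      u.appTop ((Scheme.ΓSpecIso (.of A)).inv (ψ x)) =
        v.appTop ((Scheme.ΓSpecIso (.of A)).inv (ψ x)) := by
    intro B _ ψ hψ x
    have h1 := congrArg (fun w => (Scheme.ΓSpecIso (.of B)).inv ≫ Scheme.Hom.appTop w) hψ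
    simp only [Scheme.Hom.comp_appTop] at h1
    rw [← Scheme.ΓSpecIso_inv_naturality_assoc, ← Scheme.ΓSpecIso_inv_naturality_assoc] at h1
    exact ConcreteCategory.congr_hom h1 x
  have h1 : u ≫ Spec.map (CommRingCat.ofHom (chartHom (K := K) a)) =
      v ≫ Spec.map (CommRingCat.ofHom (chartHom (K := K) a)) := by
    rw [← cancel_mono (Proj.awayι _ (MvPolynomial.X (Fin.last n))
      (X_mem_homogeneousSubmodule (Fin.last n)) one_pos)]
    simpa [toProj] using h
  have ha' : ∀ i, u.appTop ((Scheme.ΓSpecIso (.of A)).inv (a i)) =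
      v.appTop ((Scheme.ΓSpecIso (.of A)).inv (a i)) := by
    intro i
    have := key _ h1 (HomogeneousLocalization.Away.mk
      (MvPolynomial.homogeneousSubmodule (Fin (n + 1)) K)
      (X_mem_homogeneousSubmodule (Fin.last n)) 1 (MvPolynomial.X i.castSucc)
      (X_mem_homogeneousSubmodule _))
    rw [chartHom_mk] at this
    simpa using this
  apply ext_of_isAffine
  rw [← cancel_epi (Scheme.ΓSpecIso (.of A)).inv]
  ext x
  have hx : x ∈ Algebra.adjoin R (Set.range a) := ha ▸ Algebra.mem_top
  simp only [CommRingCat.hom_comp, RingHom.comp_apply]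
  induction hx using Algebra.adjoin_induction with
  | mem x hx =>
    obtain ⟨i, rfl⟩ := hx
    exact ha' i
  | algebraMap r => exact key _ h' r
  | add x y _ _ hx hy => rw [map_add, map_add, map_add, hx, hy]
  | mul x y _ _ hx hy => rw [map_mul, map_mul, map_mul, hx, hy]

/-- A finite monomorphism is a closed immersion. Finiteness is inherited from `Spec A ⟶ Spec R`,
since the projection to `Spec R` is separated. -/
theorem isClosedImmersion_lift_toProj {R A : Type u} [CommRing R] [CommRing A] [Algebra K A]
    [Algebra R A] [Module.Finite R A]
    (a : Fin n → A) (ha : Algebra.adjoin R (Set.range a) = ⊤) (s : Spec (.of R) ⟶ Spec (.of K))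
    (h : toProj a ≫ projSpaceToSpec K n =
      Spec.map (CommRingCat.ofHom (algebraMap R A)) ≫ s) :
    IsClosedImmersion (pullback.lift (toProj a) (Spec.map (CommRingCat.ofHom (algebraMap R A))) h) := by
  rw [IsClosedImmersion.iff_isFinite_and_mono]
  constructor
  · have h1 : IsFinite (pullback.lift (toProj a) (Spec.map (CommRingCat.ofHom (algebraMap R A))) h
        ≫ pullback.snd _ _) := by
      rw [pullback.lift_snd, IsFinite.SpecMap_iff]
      exact RingHom.finite_algebraMap.2 inferInstance
    exact IsFinite.of_comp _ (pullback.snd _ _)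
  · constructor
    intro W u v huv
    refine eq_of_comp_toProj_eq (R := R) (K := K) a ha u v ?_ ?_
    · rw [← pullback.lift_fst (toProj a) _ h, reassoc_of% huv]
    · rw [← pullback.lift_snd (toProj a) _ h, reassoc_of% huv]

theorem isClosedImmersion_toProj {A : Type u} [CommRing A] [Algebra K A]
    [Module.Finite K A] (a : Fin n → A) (ha : Algebra.adjoin K (Set.range a) = ⊤) :
    IsClosedImmersion (toProj (K := K) a) := by
  rw [IsClosedImmersion.iff_isFinite_and_mono]
  constructor
  · have h1 : IsFinite (toProj (K := K) a ≫ projSpaceToSpec K n) := by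
      rw [toProj_projSpaceToSpec, IsFinite.SpecMap_iff]
      exact RingHom.finite_algebraMap.2 inferInstance
    exact IsFinite.of_comp _ (projSpaceToSpec K n)
  · constructor
    intro W u v huv
    refine eq_of_comp_toProj_eq (R := K) (K := K) a ha u v huv ?_
    rw [← toProj_projSpaceToSpec (K := K) a, reassoc_of% huv]

end Apolarity

/-! ### Finite subschemes given by algebras: degree, apolarity, smoothability -/

namespace Apolarity

open scoped TensorProduct Polynomial

variable {K : Type u} [Field K] {n : ℕ}

def FiniteSubscheme.ofAlgebra (B : Type u) [CommRing B] [Algebra K B] [Module.Finite K B]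
    [Nontrivial B] (b : Fin n → B) (hb : Algebra.adjoin K (Set.range b) = ⊤) :
    FiniteSubscheme K n where
  carrier := Spec (.of B)
  ι := toProj b
  isClosedImmersion := isClosedImmersion_toProj b hb
  isFinite := by
    rw [toProj_projSpaceToSpec, IsFinite.SpecMap_iff]
    exact RingHom.finite_algebraMap.2 inferInstance
  nonempty := inferInstanceAs (Nonempty (PrimeSpectrum B))

section

variable (B : Type u) [CommRing B] [Algebra K B] [Module.Finite K B]
    [Nontrivial B] (b : Fin n → B) (hb : Algebra.adjoin K (Set.range b) = ⊤)

theorem FiniteSubscheme.toSpec_ofAlgebra : (ofAlgebra B b hb).toSpec =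
    Spec.map (CommRingCat.ofHom (algebraMap K B)) :=
  toProj_projSpaceToSpec b

theorem FiniteSubscheme.degree_ofAlgebra : (ofAlgebra B b hb).degree = Module.finrank K B := by
  unfold degree
  let : Algebra K Γ(Spec (.of B), ⊤) :=
    ((Scheme.ΓSpecIso (.of K)).inv ≫ (ofAlgebra B b hb).toSpec.appTop).hom.toAlgebra
  change Module.finrank K Γ(Spec (.of B), ⊤) = _
  refine (LinearEquiv.finrank_eq (AlgEquiv.toLinearEquiv (AlgEquiv.ofRingEquiv
    (f := (Scheme.ΓSpecIso (.of B)).symm.commRingCatIsoToRingEquiv) ?_))).symm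
  intro c
  have h : CommRingCat.ofHom (algebraMap K B) ≫ (Scheme.ΓSpecIso (.of B)).inv =
      (Scheme.ΓSpecIso (.of K)).inv ≫ (ofAlgebra B b hb).toSpec.appTop := by
    rw [toSpec_ofAlgebra]
    exact Scheme.ΓSpecIso_inv_naturality _
  exact ConcreteCategory.congr_hom h c

/-- The whole scheme lies in the chart `y_n ≠ 0`, so vanishing on that chart alone suffices. -/
theorem FiniteSubscheme.aeval_eq_zero_of_vanishes_ofAlgebra (m : ℕ)
    (f : MvPolynomial (Fin (n + 1)) K)
    (hf : f ∈ MvPolynomial.homogeneousSubmodule (Fin (n + 1)) K (m • 1))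
    (h : (ofAlgebra B b hb).Vanishes m f hf) :
    MvPolynomial.aeval (Fin.snoc b 1 : Fin (n + 1) → B) f = 0 := by
  have h0 := h (Fin.last n)
  have htop : ⊤ ≤ toProj (K := K) b ⁻¹ᵁ Proj.basicOpen _ (MvPolynomial.X (Fin.last n)) := by
    intro x _
    have : toProj (K := K) b x ∈ (Proj.awayι _ (MvPolynomial.X (Fin.last n))
      (X_mem_homogeneousSubmodule (K := K) (Fin.last n)) one_pos).opensRange :=
      ⟨Spec.map (CommRingCat.ofHom (chartHom b)) x, rfl⟩
    rwa [Proj.opensRange_awayι] at this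
  have h1 := awayToSection_comp_appLE_of_comp_awayι _
    (X_mem_homogeneousSubmodule (K := K) (Fin.last n)) one_pos (toProj b) _ rfl htop
  rw [← Scheme.ΓSpecIso_inv_naturality] at h1
  have h2 := ConcreteCategory.congr_hom h1 (HomogeneousLocalization.Away.mk _
    (X_mem_homogeneousSubmodule (Fin.last n)) m f hf)
  have h3 : (Scheme.ΓSpecIso (.of B)).inv (chartHom b (HomogeneousLocalization.Away.mk _
    (X_mem_homogeneousSubmodule (Fin.last n)) m f hf)) = 0 := by
    refine h2.symm.trans ?_
    exact (congrArg ((Spec (.of B)).presheaf.map (homOfLE htop).op).hom h0).trans (map_zero _)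
  rw [chartHom_mk] at h3
  exact (Scheme.ΓSpecIso (.of B)).symm.commRingCatIsoToRingEquiv.injective
    (h3.trans (map_zero _).symm)

theorem FiniteSubscheme.isApolar_ofAlgebra (F : MvPolynomial (Fin (n + 1)) K)
    (h : ∀ m (f : MvPolynomial (Fin (n + 1)) K), f.IsHomogeneous m →
      MvPolynomial.aeval (Fin.snoc b 1 : Fin (n + 1) → B) f = 0 → f ∈ annihilator F) :
    (ofAlgebra B b hb).IsApolar F := by
  refine Ideal.span_le.2 ?_
  rintro f ⟨m, hf, hv⟩
  exact h (m • 1) f hf (aeval_eq_zero_of_vanishes_ofAlgebra B b hb m f hf hv)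

theorem FiniteSubscheme.isSmooth_ofAlgebra [Algebra.Smooth K B] :
    (ofAlgebra B b hb).IsSmooth := by
  have h : Smooth (Spec.map (CommRingCat.ofHom (algebraMap K B))) := by
    rw [HasRingHomProperty.Spec_iff (P := @Smooth)]
    exact RingHom.smooth_algebraMap.2 inferInstance
  rwa [← toSpec_ofAlgebra B b hb] at h

end

/-- `R` injects into the residue field at the zero ideal, so the `P i` become separable there, and
the fibre algebra is generated by their roots `1 ⊗ a i`. -/
theorem smooth_fiberToSpecResidueField_of_asIdeal_eq_bot {R A : Type u} [CommRing R]
    [CommRing A] [Algebra R A] [Module.Finite R A] {ι : Type*} (a : ι → A)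
    (ha : Algebra.adjoin R (Set.range a) = ⊤) (P : ι → R[X])
    (hP : ∀ (k : Type u) [Field k] [Algebra R k], Function.Injective (algebraMap R k) →
      ∀ i, ((P i).map (algebraMap R k)).Separable)
    (haP : ∀ i, Polynomial.aeval (a i) (P i) = 0) (p : PrimeSpectrum R) (hp : p.asIdeal = ⊥) :
    Smooth ((Spec.map (CommRingCat.ofHom (algebraMap R A))).fiberToSpecResidueField p) := by
  have hinj : Function.Injective (algebraMap R p.asIdeal.ResidueField) := by
    rw [RingHom.injective_iff_ker_eq_bot, Ideal.ker_algebraMap_residueField, hp]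
  have : Algebra.Smooth p.asIdeal.ResidueField (p.asIdeal.Fiber A) := by
    refine smooth_of_adjoin_eq_top (fun i => (1 : p.asIdeal.ResidueField) ⊗ₜ[R] a i) ?_
      (fun i => (P i).map (algebraMap R _)) (hP _ hinj) fun i => ?_
    · have := Algebra.TensorProduct.adjoin_one_tmul_image_eq_top
        (A := p.asIdeal.ResidueField) _ ha
      rwa [← Set.range_comp] at this
    · have h := Polynomial.aeval_algHom_apply (Algebra.TensorProduct.includeRight :
          A →ₐ[R] p.asIdeal.ResidueField ⊗[R] A) (a i) (P i)
      rw [haP, map_zero] at h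
      rw [Polynomial.aeval_map_algebraMap]
      exact h
  have h : Smooth (Spec.map (CommRingCat.ofHom
      (algebraMap p.asIdeal.ResidueField (p.asIdeal.Fiber A)))) := by
    rw [HasRingHomProperty.Spec_iff (P := @Smooth)]
    exact RingHom.smooth_algebraMap.2 this
  have : MorphismProperty.RespectsIso @Smooth :=
    MorphismProperty.IsStableUnderBaseChange.respectsIso
  exact (MorphismProperty.arrow_mk_iso_iff @Smooth
    (Spec.fiberToSpecResidueFieldIso R A p)).2 h

/-- The family is `Spec A` over `Spec R`, the rational point is `ε`, and `hpush` identifies the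
fibre over it with `Spec B`. -/
theorem FiniteSubscheme.isSmoothable_ofAlgebra {R A : Type u} [CommRing R] [IsDomain R]
    [IsNoetherianRing R] [Algebra K R] [CommRing A] [Algebra R A] [Algebra K A]
    [IsScalarTower K R A] [Module.Finite R A] [Module.Flat R A] (a : Fin n → A)
    (ha : Algebra.adjoin R (Set.range a) = ⊤) (P : Fin n → R[X])
    (hP : ∀ (k : Type u) [Field k] [Algebra R k], Function.Injective (algebraMap R k) →
      ∀ i, ((P i).map (algebraMap R k)).Separable)
    (haP : ∀ i, Polynomial.aeval (a i) (P i) = 0)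
    (B : Type u) [CommRing B] [Algebra K B] [Module.Finite K B]
    [Nontrivial B] (b : Fin n → B) (hb : Algebra.adjoin K (Set.range b) = ⊤)
    (ε : R →+* K) (hε : ε.comp (algebraMap K R) = RingHom.id K) (f : A →+* B)
    (hfK : f.comp (algebraMap K A) = algebraMap K B) (hfab : ∀ i, f (a i) = b i)
    (hpush : IsPushout (CommRingCat.ofHom (algebraMap R A)) (CommRingCat.ofHom ε)
      (CommRingCat.ofHom f) (CommRingCat.ofHom (algebraMap K B))) :
    (ofAlgebra B b hb).IsSmoothable := by
  have hqπ : toProj (K := K) a ≫ projSpaceToSpec K n =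
      Spec.map (CommRingCat.ofHom (algebraMap R A)) ≫
        Spec.map (CommRingCat.ofHom (algebraMap K R)) := by
    rw [toProj_projSpaceToSpec, ← Spec.map_comp]
    congr 1
    ext c
    exact IsScalarTower.algebraMap_apply K R A c
  refine ⟨Spec (.of R), Spec.map (CommRingCat.ofHom (algebraMap K R)), inferInstance,
    inferInstance, Spec.map (CommRingCat.ofHom ε), ?_, Spec (.of A), toProj a,
    Spec.map (CommRingCat.ofHom (algebraMap R A)), hqπ, ?_, ?_, ?_, ?_,
    Spec.map (CommRingCat.ofHom f), ?_, ?_⟩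
  · rw [← Spec.map_comp, ← CommRingCat.ofHom_comp, hε]
    exact Spec.map_id _
  · exact isClosedImmersion_lift_toProj a ha _ hqπ
  · rw [IsFinite.SpecMap_iff]
    exact RingHom.finite_algebraMap.2 inferInstance
  · rw [Flat.SpecMap_iff]
    exact RingHom.flat_algebraMap_iff.2 inferInstance
  · refine smooth_fiberToSpecResidueField_of_asIdeal_eq_bot a ha P hP haP _ ?_
    rw [genericPoint_eq_bot_of_affine]
    rfl
  · rw [toSpec_ofAlgebra]
    exact isPullback_SpecMap_of_isPushout _ _ _ _ hpush
  · exact specMap_toProj f hfK a b hfab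

end Apolarity

/-! ### The lower bound for an arbitrary apolar subscheme -/

namespace Apolarity

variable {K : Type u} [Field K] {n : ℕ}

theorem eval₂_mul_left_of_isHomogeneous {σ R S : Type*} [CommSemiring R] [CommSemiring S]
    (j : R →+* S) (c : S) (x : σ → S) {m : ℕ} {f : MvPolynomial σ R} (hf : f.IsHomogeneous m) :
    MvPolynomial.eval₂ j (fun i => c * x i) f = c ^ m * MvPolynomial.eval₂ j x f := by
  rw [MvPolynomial.eval₂_eq, MvPolynomial.eval₂_eq, Finset.mul_sum]
  refine Finset.sum_congr rfl fun d hd => ?_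
  have hdeg : ∑ i ∈ d.support, d i = m := by
    have h := hf (MvPolynomial.mem_support_iff.1 hd)
    rwa [Pi.one_def, ← Finsupp.degree_eq_weight_one] at h
  rw [Finset.prod_congr rfl fun i _ => mul_pow c (x i) (d i), Finset.prod_mul_distrib,
    Finset.prod_pow_eq_pow_sum, hdeg]
  ring

/-- By homogeneity `f / l ^ m` is `f` evaluated at the fractions `y_i / l`, so dehomogenization by
`l` extends to an algebra map on all polynomials. -/
theorem eval₂_away_mk {l : MvPolynomial (Fin (n + 1)) K}
    (hl : l ∈ MvPolynomial.homogeneousSubmodule (Fin (n + 1)) K 1) (m : ℕ)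
    (f : MvPolynomial (Fin (n + 1)) K)
    (hf : f ∈ MvPolynomial.homogeneousSubmodule (Fin (n + 1)) K (m • 1)) :
    MvPolynomial.eval₂ ((HomogeneousLocalization.fromZeroRingHom
        (MvPolynomial.homogeneousSubmodule (Fin (n + 1)) K) (Submonoid.powers l)).comp
        (algebraMap K (MvPolynomial.homogeneousSubmodule (Fin (n + 1)) K 0)))
      (fun i => HomogeneousLocalization.Away.mk _ hl 1 (MvPolynomial.X i)
        (X_mem_homogeneousSubmodule i)) f =
      HomogeneousLocalization.Away.mk _ hl m f hf := by
  apply HomogeneousLocalization.val_injective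
  rw [← HomogeneousLocalization.algebraMap_apply, MvPolynomial.hom_eval₂,
    HomogeneousLocalization.Away.val_mk]
  have hX : (fun i : Fin (n + 1) => algebraMap (HomogeneousLocalization.Away _ l)
      (Localization.Away l) (HomogeneousLocalization.Away.mk _ hl 1 (MvPolynomial.X i)
        (X_mem_homogeneousSubmodule i))) =
      fun i => Localization.mk 1 ⟨l, Submonoid.mem_powers l⟩ *
        algebraMap (MvPolynomial (Fin (n + 1)) K) (Localization.Away l) (MvPolynomial.X i) := by
    ext1 i
    rw [HomogeneousLocalization.algebraMap_apply, HomogeneousLocalization.Away.val_mk,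
      ← Localization.mk_one_eq_algebraMap, Localization.mk_mul]
    simp
  have hC : (algebraMap (HomogeneousLocalization.Away _ l) (Localization.Away l)).comp
      ((HomogeneousLocalization.fromZeroRingHom
        (MvPolynomial.homogeneousSubmodule (Fin (n + 1)) K) (Submonoid.powers l)).comp
        (algebraMap K (MvPolynomial.homogeneousSubmodule (Fin (n + 1)) K 0))) =
      (algebraMap (MvPolynomial (Fin (n + 1)) K) (Localization.Away l)).comp MvPolynomial.C := by
    ext c
    rw [RingHom.comp_apply, RingHom.comp_apply, RingHom.comp_apply,
      fromZeroRingHom_algebraMap hl, HomogeneousLocalization.algebraMap_apply,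
      HomogeneousLocalization.Away.val_mk, ← Localization.mk_one_eq_algebraMap]
    simp only [pow_zero]
    rfl
  have hf' : f.IsHomogeneous m := by
    rwa [smul_eq_mul, mul_one] at hf
  rw [hX, hC, eval₂_mul_left_of_isHomogeneous _ _ _ hf',
    ← MvPolynomial.hom_eval₂ f MvPolynomial.C (algebraMap _ (Localization.Away l)) MvPolynomial.X,
    MvPolynomial.eval₂_eta, ← Localization.mk_one_eq_algebraMap,
    Localization.mk_pow, Localization.mk_mul]
  simp

theorem awayMap_away_mk_eq_mul {l g : MvPolynomial (Fin (n + 1)) K}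
    (hl : l ∈ MvPolynomial.homogeneousSubmodule (Fin (n + 1)) K 1)
    (hg : g ∈ MvPolynomial.homogeneousSubmodule (Fin (n + 1)) K 1) (m : ℕ)
    (f : MvPolynomial (Fin (n + 1)) K)
    (hf : f ∈ MvPolynomial.homogeneousSubmodule (Fin (n + 1)) K (m • 1)) :
    HomogeneousLocalization.awayMap _ hl (mul_comm l g)
      (HomogeneousLocalization.Away.mk _ hg m f hf) =
      HomogeneousLocalization.awayMap _ hg rfl (HomogeneousLocalization.Away.mk _ hl m f hf) *
      HomogeneousLocalization.awayMap _ hl (mul_comm l g)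
        (HomogeneousLocalization.Away.mk _ hg 1 l hl) ^ m := by
  apply HomogeneousLocalization.val_injective
  rw [HomogeneousLocalization.val_mul, HomogeneousLocalization.val_pow,
    HomogeneousLocalization.awayMap_mk, HomogeneousLocalization.awayMap_mk,
    HomogeneousLocalization.awayMap_mk, HomogeneousLocalization.Away.val_mk,
    HomogeneousLocalization.Away.val_mk, HomogeneousLocalization.Away.val_mk,
    Localization.mk_pow, Localization.mk_mul, Localization.mk_eq_mk_iff,
    Localization.r_iff_exists]
  refine ⟨1, ?_⟩
  simp only [OneMemClass.coe_one, one_mul, Submonoid.coe_mul, SubmonoidClass.coe_pow, pow_one]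
  ring

/-- As `p` lands in `D(l)`, the preimages of `D(g)` and `D(l g)` agree, and there `f / g ^ m = (f /
l ^ m) * (l / g) ^ m`. -/
theorem app_awayToSection_eq_zero {W : Scheme.{u}} (p : W ⟶ projSpace K n)
    {l g : MvPolynomial (Fin (n + 1)) K}
    (hl : l ∈ MvPolynomial.homogeneousSubmodule (Fin (n + 1)) K 1)
    (hg : g ∈ MvPolynomial.homogeneousSubmodule (Fin (n + 1)) K 1)
    (h : ⊤ ≤ p ⁻¹ᵁ Proj.basicOpen (MvPolynomial.homogeneousSubmodule (Fin (n + 1)) K) l)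
    (m : ℕ) (f : MvPolynomial (Fin (n + 1)) K)
    (hf : f ∈ MvPolynomial.homogeneousSubmodule (Fin (n + 1)) K (m • 1))
    (h0 : p.appLE _ ⊤ h (Proj.awayToSection _ l
      (HomogeneousLocalization.Away.mk _ hl m f hf)) = 0) :
    p.app (Proj.basicOpen _ g) (Proj.awayToSection _ g
      (HomogeneousLocalization.Away.mk _ hg m f hf)) = 0 := by
  have e : p ⁻¹ᵁ Proj.basicOpen _ g ≤
      p ⁻¹ᵁ Proj.basicOpen (MvPolynomial.homogeneousSubmodule (Fin (n + 1)) K) (l * g) := by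
    intro x hx
    rw [Proj.basicOpen_mul]
    exact ⟨h trivial, hx⟩
  have h3 : CommRingCat.ofHom (HomogeneousLocalization.awayMap _ hg rfl) ≫
      Proj.awayToSection (MvPolynomial.homogeneousSubmodule (Fin (n + 1)) K) (l * g) ≫
        p.appLE _ (p ⁻¹ᵁ Proj.basicOpen _ g) e = Proj.awayToSection _ l ≫ p.appLE _ ⊤ h ≫
        W.presheaf.map (homOfLE (le_top : p ⁻¹ᵁ Proj.basicOpen _ g ≤ ⊤)).op := by
    rw [Proj.awayMap_awayToSection_assoc, Scheme.Hom.map_appLE, Scheme.Hom.appLE_map]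
  have h5 : CommRingCat.ofHom (HomogeneousLocalization.awayMap _ hl (mul_comm l g)) ≫
      Proj.awayToSection (MvPolynomial.homogeneousSubmodule (Fin (n + 1)) K) (l * g) ≫
        p.appLE _ (p ⁻¹ᵁ Proj.basicOpen _ g) e = Proj.awayToSection _ g ≫ p.app _ := by
    rw [Proj.awayMap_awayToSection_assoc, Scheme.Hom.map_appLE, Scheme.Hom.app_eq_appLE]
  replace h3 := RingHom.congr_fun (congrArg CommRingCat.Hom.hom h3)
    (HomogeneousLocalization.Away.mk _ hl m f hf)
  replace h5 := RingHom.congr_fun (congrArg CommRingCat.Hom.hom h5)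
    (HomogeneousLocalization.Away.mk _ hg m f hf)
  simp only [CommRingCat.hom_comp, CommRingCat.hom_ofHom, RingHom.comp_apply] at h3 h5
  rw [h0, map_zero] at h3
  rw [← h5, awayMap_away_mk_eq_mul hl hg, map_mul, map_mul, h3, zero_mul]

variable (Γ : FiniteSubscheme K n)

theorem FiniteSubscheme.vanishes_of_appLE_eq_zero {l : MvPolynomial (Fin (n + 1)) K}
    (hl : l ∈ MvPolynomial.homogeneousSubmodule (Fin (n + 1)) K 1)
    (h : ⊤ ≤ Γ.ι ⁻¹ᵁ Proj.basicOpen (MvPolynomial.homogeneousSubmodule (Fin (n + 1)) K) l)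
    (m : ℕ) (f : MvPolynomial (Fin (n + 1)) K)
    (hf : f ∈ MvPolynomial.homogeneousSubmodule (Fin (n + 1)) K (m • 1))
    (h0 : Γ.ι.appLE _ ⊤ h (Proj.awayToSection _ l
      (HomogeneousLocalization.Away.mk _ hl m f hf)) = 0) :
    Γ.Vanishes m f hf :=
  fun i => app_awayToSection_eq_zero Γ.ι hl (X_mem_homogeneousSubmodule i) h m f hf h0

theorem FiniteSubscheme.finite_carrier : Finite Γ.carrier := by
  have : IsFinite Γ.toSpec := Γ.isFinite
  have h := Γ.toSpec.finite_preimage (s := Set.univ) (Set.toFinite _)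
  rw [Set.preimage_univ] at h
  exact Set.finite_univ_iff.1 h

theorem exists_X_notMem (x : projSpace K n) :
    ∃ i, (MvPolynomial.X i : MvPolynomial (Fin (n + 1)) K) ∉ x.asHomogeneousIdeal.toIdeal := by
  have h := Proj.iSup_basicOpen_eq_top' (MvPolynomial.homogeneousSubmodule (Fin (n + 1)) K)
    (fun i : Fin (n + 1) => MvPolynomial.X i) (fun i => ⟨1, X_mem_homogeneousSubmodule i⟩) (by
      rw [eq_top_iff]
      rintro f -
      induction f using MvPolynomial.induction_on with
      | C c =>
        exact Subalgebra.algebraMap_mem (Algebra.adjoin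
          (MvPolynomial.homogeneousSubmodule (Fin (n + 1)) K 0)
          (Set.range fun i : Fin (n + 1) => (MvPolynomial.X i : MvPolynomial (Fin (n + 1)) K)))
          ⟨MvPolynomial.C c, C_mem_homogeneousSubmodule c⟩
      | add f g hf hg => exact add_mem hf hg
      | mul_X f i hf => exact mul_mem hf (Algebra.subset_adjoin ⟨i, rfl⟩))
  have hx : x ∈ ⨆ i, Proj.basicOpen (MvPolynomial.homogeneousSubmodule (Fin (n + 1)) K)
      (MvPolynomial.X i) := h ▸ trivial
  exact TopologicalSpace.Opens.mem_iSup.1 hx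

theorem sum_smul_X_mem_homogeneousSubmodule (c : Fin (n + 1) → K) :
    ∑ i, c i • (MvPolynomial.X i : MvPolynomial (Fin (n + 1)) K) ∈
      MvPolynomial.homogeneousSubmodule (Fin (n + 1)) K 1 :=
  Submodule.sum_mem _ fun i _ => Submodule.smul_mem _ (c i) (X_mem_homogeneousSubmodule i)

theorem FiniteSubscheme.exists_linear_form [Infinite K] :
    ∃ c : Fin (n + 1) → K, ⊤ ≤ Γ.ι ⁻¹ᵁ Proj.basicOpen
      (MvPolynomial.homogeneousSubmodule (Fin (n + 1)) K) (∑ i, c i • MvPolynomial.X i) := by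
  have := Γ.finite_carrier
  obtain ⟨c, hc⟩ := exists_sum_smul_notMem (K := K)
    (fun i : Fin (n + 1) => (MvPolynomial.X i : MvPolynomial (Fin (n + 1)) K))
    (fun x : Γ.carrier => (Γ.ι x).asHomogeneousIdeal.toIdeal) fun x => exists_X_notMem _
  exact ⟨c, fun x _ => hc x⟩

/-- `φ` is dehomogenization by a linear form `l` missing `Γ`. Since `φ l = 1`, the images of the
variables generate the unit ideal. -/
theorem FiniteSubscheme.exists_algHom [Infinite K] :
    letI : Algebra K Γ(Γ.carrier, ⊤) :=
      ((Scheme.ΓSpecIso (.of K)).inv ≫ Γ.toSpec.appTop).hom.toAlgebra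
    Module.Finite K Γ(Γ.carrier, ⊤) ∧
    ∃ φ : MvPolynomial (Fin (n + 1)) K →ₐ[K] Γ(Γ.carrier, ⊤),
      Ideal.span (Set.range fun i => φ (MvPolynomial.X i)) = ⊤ ∧
      ∀ m (f : MvPolynomial (Fin (n + 1)) K)
        (hf : f ∈ MvPolynomial.homogeneousSubmodule (Fin (n + 1)) K (m • 1)),
        φ f = 0 → Γ.Vanishes m f hf := by
  let : Algebra K Γ(Γ.carrier, ⊤) :=
    ((Scheme.ΓSpecIso (.of K)).inv ≫ Γ.toSpec.appTop).hom.toAlgebra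
  obtain ⟨c, hc⟩ := Γ.exists_linear_form
  have hl := sum_smul_X_mem_homogeneousSubmodule c
  set l : MvPolynomial (Fin (n + 1)) K := ∑ i, c i • MvPolynomial.X i
  let k : Γ.carrier ⟶ Spec (.of (HomogeneousLocalization.Away
      (MvPolynomial.homogeneousSubmodule (Fin (n + 1)) K) l)) :=
    IsOpenImmersion.lift (Proj.awayι _ l hl one_pos) Γ.ι (by
      rintro _ ⟨x, rfl⟩
      have hx := hc (show x ∈ ⊤ from trivial)
      rw [← Proj.opensRange_awayι _ _ hl one_pos] at hx
      exact hx)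
  have hk : k ≫ Proj.awayι _ l hl one_pos = Γ.ι := IsOpenImmersion.lift_fac _ _ _
  have hψ := awayToSection_comp_appLE_of_comp_awayι _ hl one_pos Γ.ι k hk hc
  let ψ : HomogeneousLocalization.Away (MvPolynomial.homogeneousSubmodule (Fin (n + 1)) K) l →+*
    Γ(Γ.carrier, ⊤) := (Proj.awayToSection _ l ≫ Γ.ι.appLE _ ⊤ hc).hom
  have hψK : ψ.comp ((HomogeneousLocalization.fromZeroRingHom
      (MvPolynomial.homogeneousSubmodule (Fin (n + 1)) K) (Submonoid.powers l)).comp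
      (algebraMap K (MvPolynomial.homogeneousSubmodule (Fin (n + 1)) K 0))) =
      algebraMap K Γ(Γ.carrier, ⊤) := by
    have h1 : Γ.toSpec = k ≫ Spec.map (CommRingCat.ofHom ((HomogeneousLocalization.fromZeroRingHom
        (MvPolynomial.homogeneousSubmodule (Fin (n + 1)) K) (Submonoid.powers l)).comp
        (algebraMap K (MvPolynomial.homogeneousSubmodule (Fin (n + 1)) K 0)))) := by
      unfold toSpec projSpaceToSpec
      rw [← hk, Category.assoc, Proj.awayι_toSpecZero_assoc, CommRingCat.ofHom_comp, Spec.map_comp]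
    have h2 : (Scheme.ΓSpecIso (.of K)).inv ≫ Γ.toSpec.appTop = CommRingCat.ofHom
        ((HomogeneousLocalization.fromZeroRingHom
        (MvPolynomial.homogeneousSubmodule (Fin (n + 1)) K) (Submonoid.powers l)).comp
        (algebraMap K (MvPolynomial.homogeneousSubmodule (Fin (n + 1)) K 0))) ≫
        (Scheme.ΓSpecIso _).inv ≫ k.appTop := by
      rw [h1, Scheme.Hom.comp_appTop, Scheme.ΓSpecIso_inv_naturality_assoc]
    rw [← hψ] at h2
    exact (congrArg CommRingCat.Hom.hom h2).symm
  let φ : MvPolynomial (Fin (n + 1)) K →ₐ[K] Γ(Γ.carrier, ⊤) := MvPolynomial.aeval fun i =>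
    ψ (HomogeneousLocalization.Away.mk _ hl 1 (MvPolynomial.X i) (X_mem_homogeneousSubmodule i))
  have hφ : ∀ m (f : MvPolynomial (Fin (n + 1)) K)
      (hf : f ∈ MvPolynomial.homogeneousSubmodule (Fin (n + 1)) K (m • 1)),
      φ f = ψ (HomogeneousLocalization.Away.mk _ hl m f hf) := by
    intro m f hf
    rw [← eval₂_away_mk hl m f hf, MvPolynomial.hom_eval₂, hψK]
    rfl
  refine ⟨?_, φ, ?_, ?_⟩
  · have : IsFinite Γ.toSpec := Γ.isFinite
    have h1 : ((Scheme.ΓSpecIso (.of K)).inv ≫ Γ.toSpec.appTop).hom.Finite :=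
      Γ.toSpec.finite_appTop.comp
        (RingHom.Finite.of_surjective _ (Scheme.ΓSpecIso (.of K)).symm.commRingCatIsoToRingEquiv.surjective)
    exact h1
  · have h1 : φ l = 1 := by
      rw [hφ 1 l hl, ← map_one ψ]
      congr 1
      apply HomogeneousLocalization.val_injective
      rw [HomogeneousLocalization.Away.val_mk, HomogeneousLocalization.val_one]
      simp only [pow_one]
      exact Localization.mk_self (⟨l, _⟩ : Submonoid.powers l)
    rw [Ideal.eq_top_iff_one, ← h1]
    simp only [l, map_sum, map_smul]
    refine Submodule.sum_mem _ fun i _ => ?_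
    rw [Algebra.smul_def]
    exact Ideal.mul_mem_left _ _ (Ideal.subset_span ⟨i, rfl⟩)
  · intro m f hf h0
    rw [hφ m f hf] at h0
    exact Γ.vanishes_of_appLE_eq_zero hl hc m f hf h0

theorem FiniteSubscheme.prod_le_mul_degree [CharZero K] (d : Fin (n + 1) → ℕ) (δ : ℕ)
    (hδ : ∀ i, d i + 1 ≤ δ)
    (h : Γ.IsApolar (∏ i, (MvPolynomial.X i : MvPolynomial (Fin (n + 1)) K) ^ d i)) :
    ∏ i, (d i + 1) ≤ δ * Γ.degree := by
  obtain ⟨hfin, φ, hφ, hv⟩ := Γ.exists_algHom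
  let : Algebra K Γ(Γ.carrier, ⊤) :=
      ((Scheme.ΓSpecIso (.of K)).inv ≫ Γ.toSpec.appTop).hom.toAlgebra
  have : Module.Finite K Γ(Γ.carrier, ⊤) := hfin
  have : IsArtinianRing Γ(Γ.carrier, ⊤) := .of_finite K _
  -- An Artinian ring has finitely many primes, and none contains every `φ (X i)`, hence none
  -- contains every `δ`-th power.
  obtain ⟨c, hc⟩ := exists_sum_smul_notMem (K := K)
    (fun i : Fin (n + 1) => φ (MvPolynomial.X i) ^ δ)
    (fun p : PrimeSpectrum Γ(Γ.carrier, ⊤) => p.asIdeal) (by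
      intro p
      by_contra! H
      refine p.isPrime.ne_top (top_le_iff.1 (hφ.symm.le.trans (Ideal.span_le.2 ?_)))
      rintro _ ⟨i, rfl⟩
      exact p.isPrime.mem_of_pow_mem _ (H i))
  let g : MvPolynomial (Fin (n + 1)) K := ∑ i, c i • MvPolynomial.X i ^ δ
  have hg : g ∈ annihilator (∏ i, (MvPolynomial.X i : MvPolynomial (Fin (n + 1)) K) ^ d i) := by
    refine Submodule.sum_mem _ fun i _ => ?_
    rw [annihilator_prod_X_pow, ← Nat.sub_add_cancel (hδ i), pow_add, MvPolynomial.smul_eq_C_mul]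
    exact Ideal.mul_mem_left _ _ (Ideal.mul_mem_left _ _ (Ideal.subset_span ⟨i, rfl⟩))
  refine prod_le_mul_finrank φ (Finsupp.equivFunOnFinite.symm d) ?_ δ g ?_ ?_ ?_
  · intro m f hf h0 α hα
    have hf' : f ∈ MvPolynomial.homogeneousSubmodule (Fin (n + 1)) K (m • 1) := by
      rwa [smul_eq_mul, mul_one]
    have := h (Ideal.subset_span ⟨m, hf', hv m f hf' h0⟩)
    exact (mem_annihilator_prod_iff d f).1 this α hα
  · refine Submodule.sum_mem (MvPolynomial.homogeneousSubmodule (Fin (n + 1)) K δ) fun i _ =>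
      Submodule.smul_mem _ _ ?_
    exact MvPolynomial.isHomogeneous_X_pow i δ
  · by_contra hu
    obtain ⟨M, hM, hgM⟩ := exists_max_ideal_of_mem_nonunits hu
    refine hc ⟨M, hM.isPrime⟩ ?_
    simpa [g] using hgM
  · intro f α hα
    exact (mem_annihilator_prod_iff d _).1 (Ideal.mul_mem_right f _ hg) α hα

end Apolarity

/-! ### Apolar schemes attaining the bounds -/

namespace Apolarity

open scoped TensorProduct Polynomial

variable {K : Type u} [Field K] {n : ℕ}

/-- `ℓ` reads off the coefficient of `α`. It need only separate `α` from exponents of the same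
degree because `f` is homogeneous; this compensates for setting the last variable to 1. -/
theorem coeff_eq_zero_of_apply_aeval_snoc_eq_zero {C : Type*} [CommRing C] [Algebra K C]
    (c : Fin n → C) (ℓ : C →ₗ[K] K) (α : Fin (n + 1) →₀ ℕ)
    (hℓ : ∀ γ : Fin (n + 1) →₀ ℕ, γ.degree = α.degree →
      ℓ (∏ i, c i ^ γ i.castSucc) = if γ = α then 1 else 0)
    {m : ℕ} {f : MvPolynomial (Fin (n + 1)) K} (hf : f.IsHomogeneous m)
    (h : ℓ (MvPolynomial.aeval (Fin.snoc c 1 : Fin (n + 1) → C) f) = 0) :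
    f.coeff α = 0 := by
  by_contra hα
  have hdeg : ∀ γ, f.coeff γ ≠ 0 → γ.degree = m := by
    intro γ hγ
    have := hf hγ
    rwa [Pi.one_def, ← Finsupp.degree_eq_weight_one] at this
  rw [MvPolynomial.aeval_def, MvPolynomial.eval₂_eq', map_sum] at h
  have : ∀ γ ∈ f.support, ℓ (algebraMap K C (f.coeff γ) *
      ∏ i, (Fin.snoc c 1 : Fin (n + 1) → C) i ^ γ i) = if γ = α then f.coeff γ else 0 := by
    intro γ hγ
    rw [← Algebra.smul_def, map_smul, Fin.prod_univ_castSucc]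
    simp only [Fin.snoc_castSucc, Fin.snoc_last, one_pow, mul_one]
    rw [hℓ γ ((hdeg γ (MvPolynomial.mem_support_iff.1 hγ)).trans (hdeg α hα).symm)]
    simp
  rw [Finset.sum_congr rfl this, Finset.sum_ite_eq' f.support α,
    if_pos (MvPolynomial.mem_support_iff.2 hα)] at h
  exact hα h

theorem ext_of_castSucc_of_degree {γ α : Fin (n + 1) →₀ ℕ} (hdeg : γ.degree = α.degree)
    (h : ∀ i : Fin n, γ i.castSucc = α i.castSucc) : γ = α := by
  rw [Finsupp.degree_eq_sum, Finsupp.degree_eq_sum, Fin.sum_univ_castSucc,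
    Fin.sum_univ_castSucc, Finset.sum_congr rfl fun i _ => h i] at hdeg
  ext i
  refine Fin.lastCases ?_ h i
  omega

/-- Equality of degrees forces the congruence in the last coordinate too. Each `α i` is a least
residue, so `α ≤ γ`, and equal sums give equality. -/
theorem ext_of_modEq_of_degree {e : ℕ} {γ α : Fin (n + 1) →₀ ℕ} (hα : ∀ i, α i ≤ e)
    (hdeg : γ.degree = α.degree) (h : ∀ i : Fin n, γ i.castSucc ≡ α i.castSucc [MOD e + 1]) :
    γ = α := by
  have hlast : γ (Fin.last n) ≡ α (Fin.last n) [MOD e + 1] := by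
    rw [Finsupp.degree_eq_sum, Finsupp.degree_eq_sum, Fin.sum_univ_castSucc,
      Fin.sum_univ_castSucc] at hdeg
    have h1 : ∑ i : Fin n, γ i.castSucc ≡ ∑ i : Fin n, α i.castSucc [MOD e + 1] := by
      rw [← ZMod.natCast_eq_natCast_iff]
      push_cast
      exact Finset.sum_congr rfl fun i _ => (ZMod.natCast_eq_natCast_iff _ _ _).2 (h i)
    exact Nat.ModEq.add_left_cancel h1 (congrArg (· % (e + 1)) hdeg)
  have hle : ∀ i, α i ≤ γ i := by
    intro i
    have : γ i ≡ α i [MOD e + 1] := Fin.lastCases hlast h i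
    rw [← Nat.mod_eq_of_lt (Nat.lt_succ_of_le (hα i)), ← this]
    exact Nat.mod_le _ _
  rw [Finsupp.degree_eq_sum, Finsupp.degree_eq_sum] at hdeg
  ext i
  exact ((Finset.sum_eq_sum_iff_of_le fun i _ => hle i).1 hdeg.symm i (Finset.mem_univ i)).symm

theorem mem_annihilator_of_aeval_mem_span [CharZero K] (d : Fin (n + 1) → ℕ) {m : ℕ}
    {f : MvPolynomial (Fin (n + 1)) K} (hf : f.IsHomogeneous m)
    (h : MvPolynomial.aeval (Fin.snoc MvPolynomial.X 1 : Fin (n + 1) → MvPolynomial (Fin n) K) f ∈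
      Ideal.span (Set.range fun i : Fin n =>
        (MvPolynomial.X i : MvPolynomial (Fin n) K) ^ (d i.castSucc + 1))) :
    f ∈ annihilator (∏ i, (MvPolynomial.X i : MvPolynomial (Fin (n + 1)) K) ^ d i) := by
  classical
  rw [mem_annihilator_prod_iff]
  intro α hα
  rw [mem_span_X_pow_iff fun i : Fin n => d i.castSucc + 1] at h
  let α' : Fin n →₀ ℕ := Finsupp.equivFunOnFinite.symm fun i => α i.castSucc
  refine coeff_eq_zero_of_apply_aeval_snoc_eq_zero _ (MvPolynomial.lcoeff K α') α ?_ hf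
    (h α' fun i => Nat.lt_succ_of_le (hα _))
  intro γ hγ
  have : ∏ i, (MvPolynomial.X i : MvPolynomial (Fin n) K) ^ γ i.castSucc =
      MvPolynomial.monomial (Finsupp.equivFunOnFinite.symm fun i => γ i.castSucc) 1 := by
    rw [MvPolynomial.monomial_eq, Finsupp.prod_fintype _ _ (by simp)]
    simp
  rw [this, MvPolynomial.lcoeff_apply, MvPolynomial.coeff_monomial]
  refine if_congr ⟨fun h => ext_of_castSucc_of_degree hγ fun i => ?_, ?_⟩ rfl rfl
  · exact congrFun (Finsupp.equivFunOnFinite.symm.injective h) i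
  · rintro rfl
    rfl

/-- The group algebra of `(ℤ/(e+1))^n` models `K[y] / (y_i ^ (e+1) - 1)` with an explicit monomial
basis, whose coordinate functionals play the role of `ℓ`. -/
theorem mem_annihilator_of_aeval_single_eq_zero [CharZero K] (e : ℕ) {m : ℕ}
    {f : MvPolynomial (Fin (n + 1)) K} (hf : f.IsHomogeneous m)
    (h : MvPolynomial.aeval (Fin.snoc (fun i => AddMonoidAlgebra.single (Pi.single i 1) 1) 1 :
      Fin (n + 1) → AddMonoidAlgebra K (Fin n → ZMod (e + 1))) f = 0) :
    f ∈ annihilator (∏ i, (MvPolynomial.X i : MvPolynomial (Fin (n + 1)) K) ^ e) := by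
  classical
  rw [mem_annihilator_prod_iff]
  intro α hα
  let ℓ : AddMonoidAlgebra K (Fin n → ZMod (e + 1)) →ₗ[K] K :=
    { toFun := fun x => x.coeff fun i => (α i.castSucc : ZMod (e + 1))
      map_add' := by simp
      map_smul' := by simp }
  refine coeff_eq_zero_of_apply_aeval_snoc_eq_zero _ ℓ α ?_ hf (by rw [h, map_zero])
  intro γ hγ
  have : ∏ i : Fin n, (AddMonoidAlgebra.single (Pi.single i 1) 1 :
      AddMonoidAlgebra K (Fin n → ZMod (e + 1))) ^ γ i.castSucc =
      AddMonoidAlgebra.single (fun i => (γ i.castSucc : ZMod (e + 1))) 1 := by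
    simp only [AddMonoidAlgebra.single_pow, one_pow]
    rw [AddMonoidAlgebra.prod_single]
    simp only [Finset.prod_const_one]
    congr 1
    ext j
    simp [Finset.sum_apply, Pi.single_apply]
  rw [this]
  change (AddMonoidAlgebra.single (fun i => (γ i.castSucc : ZMod (e + 1))) (1 : K)).coeff
    (fun i : Fin n => (α i.castSucc : ZMod (e + 1))) = _
  rw [AddMonoidAlgebra.coeff_single, Finsupp.single_apply]
  refine if_congr ⟨fun h => ext_of_modEq_of_degree hα hγ fun i => ?_, ?_⟩ rfl rfl
  · exact (ZMod.natCast_eq_natCast_iff _ _ _).1 (congrFun h i)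
  · rintro rfl
    rfl

theorem map_aeval_snoc {A B : Type*} [CommRing A] [Algebra K A] [CommRing B] [Algebra K B]
    (g : A →ₐ[K] B) (a : Fin n → A) (b : Fin n → B) (h : ∀ i, g (a i) = b i)
    (f : MvPolynomial (Fin (n + 1)) K) :
    g (MvPolynomial.aeval (Fin.snoc a 1 : Fin (n + 1) → A) f) =
      MvPolynomial.aeval (Fin.snoc b 1 : Fin (n + 1) → B) f := by
  rw [← AlgHom.comp_apply, MvPolynomial.comp_aeval]
  congr 2
  ext i
  refine Fin.lastCases ?_ (fun i => ?_) i
  · simp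
  · simp [h]

theorem exists_smooth_isApolar [CharZero K] (n e : ℕ) :
    ∃ Γ : FiniteSubscheme K n, (Γ.IsSmooth ∧ Γ.IsApolar
      (∏ i, (MvPolynomial.X i : MvPolynomial (Fin (n + 1)) K) ^ e)) ∧ Γ.degree = (e + 1) ^ n := by
  obtain ⟨B, _, _, b, _, _, hrank, hb, hroot, hlift⟩ := exists_free_algebra_adjoin_roots K
    (fun _ : Fin n => (Polynomial.X ^ (e + 1) - 1 : K[X]))
    fun _ => Polynomial.monic_X_pow_sub_C 1 e.succ_ne_zero
  have hrank' : Module.finrank K B = (e + 1) ^ n := by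
    have : (Polynomial.X ^ (e + 1) - 1 : K[X]).natDegree = e + 1 :=
      Polynomial.natDegree_X_pow_sub_C (r := 1)
    rw [hrank]
    simp [this]
  have : Nontrivial B := Module.nontrivial_of_finrank_pos (R := K) (by rw [hrank']; positivity)
  have : Algebra.Smooth K B := smooth_of_adjoin_eq_top b hb _
    (fun _ => Polynomial.X_pow_sub_one_separable_iff.2 (Nat.cast_ne_zero.2 e.succ_ne_zero)) hroot
  refine ⟨.ofAlgebra B b hb, ⟨FiniteSubscheme.isSmooth_ofAlgebra B b hb,
    FiniteSubscheme.isApolar_ofAlgebra B b hb _ fun m f hf h0 => ?_⟩,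
    (FiniteSubscheme.degree_ofAlgebra B b hb).trans hrank'⟩
  -- A homomorphism to the group algebra is enough: only the vanishing of `f(b, 1)` has to be
  -- transported.
  obtain ⟨g, hg⟩ := hlift (AddMonoidAlgebra K (Fin n → ZMod (e + 1)))
    (fun i => AddMonoidAlgebra.single (Pi.single i 1) 1) fun i => by
      rw [map_sub, map_pow, Polynomial.aeval_X, map_one, AddMonoidAlgebra.single_pow, one_pow,
        sub_eq_zero, AddMonoidAlgebra.one_def]
      congr 1
      ext j
      rcases eq_or_ne j i with rfl | hij
      · simp
      · simp [hij]
  refine mem_annihilator_of_aeval_single_eq_zero e hf ?_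
  rw [← map_aeval_snoc g b _ hg, h0, map_zero]

theorem separable_map_prod_X_sub_C [CharZero K] {k : Type u} [Field k] [Algebra K[X] k]
    (hk : Function.Injective (algebraMap K[X] k)) (d : ℕ) :
    ((∏ j ∈ Finset.range d, (Polynomial.X - Polynomial.C ((j : K[X]) * Polynomial.X)) :
      K[X][X]).map (algebraMap K[X] k)).Separable := by
  have : CharZero k := charZero_of_injective_ringHom hk
  rw [Polynomial.map_prod]
  simp only [Polynomial.map_sub, Polynomial.map_X, Polynomial.map_C]
  rw [Polynomial.separable_prod_X_sub_C_iff']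
  intro x _ y _ hxy
  rw [map_mul, map_mul, map_natCast, map_natCast] at hxy
  have hs : algebraMap K[X] k Polynomial.X ≠ 0 := by
    rw [Ne, map_eq_zero_iff _ hk]
    exact Polynomial.X_ne_zero
  exact Nat.cast_injective (mul_right_cancel₀ hs hxy)

theorem exists_smoothable_isApolar [CharZero K] (d : Fin (n + 1) → ℕ) :
    ∃ Γ : FiniteSubscheme K n, (Γ.IsSmoothable ∧ Γ.IsApolar
      (∏ i, (MvPolynomial.X i : MvPolynomial (Fin (n + 1)) K) ^ d i)) ∧
      Γ.degree = ∏ i : Fin n, (d i.castSucc + 1) := by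
  -- The roots `0, t, …, d_i t` are distinct at the generic point and collapse at `t = 0`, leaving
  -- `y ^ (d_i + 1)`.
  let P (i : Fin n) : K[X][X] := ∏ j ∈ Finset.range (d i.castSucc + 1),
    (Polynomial.X - Polynomial.C ((j : K[X]) * Polynomial.X))
  obtain ⟨A, _, _, a, _, _, hrank, ha, hroot, hlift⟩ := exists_free_algebra_adjoin_roots K[X] P
    fun i => Polynomial.monic_prod_X_sub_C _ _
  let : Algebra K A := ((algebraMap K[X] A).comp (algebraMap K K[X])).toAlgebra
  have : IsScalarTower K K[X] A := .of_algebraMap_eq fun _ => rfl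
  let ε : K[X] →+* K := Polynomial.evalRingHom 0
  -- `K` becomes a `K[t]`-algebra through `t ↦ 0`, so `K ⊗ A` is the special fibre.
  let : Algebra K[X] K := ε.toAlgebra
  have hrank' : Module.finrank K (K ⊗[K[X]] A) = ∏ i : Fin n, (d i.castSucc + 1) := by
    rw [Module.finrank_baseChange, hrank]
    exact Finset.prod_congr rfl fun i _ =>
      (Polynomial.natDegree_finsetProd_X_sub_C_eq_card _ _).trans (Finset.card_range _)
  have : Nontrivial (K ⊗[K[X]] A) := Module.nontrivial_of_finrank_pos (R := K)
    (by rw [hrank']; positivity)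
  have hb : Algebra.adjoin K (Set.range fun i => (1 : K) ⊗ₜ[K[X]] a i) = ⊤ := by
    have := Algebra.TensorProduct.adjoin_one_tmul_image_eq_top (A := K) _ ha
    rwa [← Set.range_comp] at this
  refine ⟨.ofAlgebra (K ⊗[K[X]] A) (fun i => 1 ⊗ₜ a i) hb, ⟨?_, ?_⟩,
    (FiniteSubscheme.degree_ofAlgebra _ _ hb).trans hrank'⟩
  · refine FiniteSubscheme.isSmoothable_ofAlgebra a ha P
      (fun k _ _ hk i => separable_map_prod_X_sub_C hk _) hroot _ _ hb ε ?_
      (Algebra.TensorProduct.includeRight : A →ₐ[K[X]] K ⊗[K[X]] A).toRingHom ?_ (fun _ => rfl)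
      (CommRingCat.isPushout_tensorProduct K[X] K A).flip
    · ext c
      simp [ε]
    · ext c
      change (1 : K) ⊗ₜ[K[X]] (algebraMap K[X] A (Polynomial.C c)) = c ⊗ₜ[K[X]] (1 : A)
      rw [Algebra.algebraMap_eq_smul_one, ← TensorProduct.smul_tmul, Algebra.smul_def, mul_one]
      congr 1
      exact Polynomial.eval_C
  · refine FiniteSubscheme.isApolar_ofAlgebra _ _ hb _ fun m f hf h0 => ?_
    let I : Ideal (MvPolynomial (Fin n) K) := Ideal.span (Set.range fun i : Fin n =>
        (MvPolynomial.X i : MvPolynomial (Fin n) K) ^ (d i.castSucc + 1))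
    obtain ⟨g, hg⟩ := hlift (MvPolynomial (Fin n) K ⧸ I)
      (fun i => Ideal.Quotient.mk I (MvPolynomial.X i)) fun i => by
        have h1 : algebraMap K[X] (MvPolynomial (Fin n) K ⧸ I) Polynomial.X = 0 := by
          rw [IsScalarTower.algebraMap_apply K[X] K]
          change algebraMap K _ (Polynomial.eval 0 Polynomial.X) = 0
          rw [Polynomial.eval_X, map_zero]
        simp only [P, map_prod, map_sub, Polynomial.aeval_X, Polynomial.aeval_C, map_mul, h1,
          mul_zero, sub_zero, Finset.prod_const, Finset.card_range]
        rw [← map_pow, Ideal.Quotient.eq_zero_iff_mem]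
        exact Ideal.subset_span ⟨i, rfl⟩
    let G : K ⊗[K[X]] A →ₐ[K] MvPolynomial (Fin n) K ⧸ I :=
      Algebra.TensorProduct.lift (Algebra.ofId K _) g fun _ _ => mul_comm _ _
    have hG : ∀ i, G (1 ⊗ₜ a i) = Ideal.Quotient.mkₐ K I (MvPolynomial.X i) := by
      intro i
      refine (Algebra.TensorProduct.lift_tmul _ _ _ _ _).trans ?_
      rw [map_one, one_mul, hg]
      rfl
    refine mem_annihilator_of_aeval_mem_span d hf (Ideal.Quotient.eq_zero_iff_mem.1 ?_)
    have h1 := map_aeval_snoc (Ideal.Quotient.mkₐ K I) MvPolynomial.X _ (fun _ => rfl) f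
    refine h1.trans ?_
    rw [← map_aeval_snoc G _ _ hG, h0, map_zero]

/-- Monotonicity makes `d_n + 1` an admissible `δ`, and it is exactly the factor to cancel. -/
theorem FiniteSubscheme.prod_castSucc_le_degree [CharZero K] (d : Fin (n + 1) → ℕ)
    (hd : Monotone d) (Γ : FiniteSubscheme K n)
    (h : Γ.IsApolar (∏ i, (MvPolynomial.X i : MvPolynomial (Fin (n + 1)) K) ^ d i)) :
    ∏ i : Fin n, (d i.castSucc + 1) ≤ Γ.degree := by
  have := Γ.prod_le_mul_degree d (d (Fin.last n) + 1)
    (fun i => Nat.succ_le_succ (hd (Fin.le_last i))) h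
  rw [Fin.prod_univ_castSucc, mul_comm] at this
  exact Nat.le_of_mul_le_mul_left this (Nat.succ_pos _)

end Apolarity

end

theorem mainTheorem2 {K : Type u} [Field K] [CharZero K] (n : ℕ) (d : Fin (n + 1) → ℕ)
    (hd : Monotone d) (F : MvPolynomial (Fin (n + 1)) K)
    (hF : F = ∏ i, MvPolynomial.X i ^ d i) :
    Apolarity.annihilator F =
        Ideal.span (Set.range fun i : Fin (n + 1) =>
          (MvPolynomial.X i ^ (d i + 1) : MvPolynomial (Fin (n + 1)) K)) ∧
      Apolarity.cactusRank F = ((∏ i : Fin n, (d i.castSucc + 1) : ℕ) : ℕ∞) ∧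
      Apolarity.smoothableRank F = ((∏ i : Fin n, (d i.castSucc + 1) : ℕ) : ℕ∞) ∧
      ∀ e : ℕ, (∀ i, d i = e) →
        Apolarity.rank F = (((e + 1) ^ n : ℕ) : ℕ∞) ∧
        Apolarity.cactusRank F = (((e + 1) ^ n : ℕ) : ℕ∞) ∧
        Apolarity.smoothableRank F = (((e + 1) ^ n : ℕ) : ℕ∞) := by
  subst hF
  have hlower := Apolarity.FiniteSubscheme.prod_castSucc_le_degree (K := K) d hd
  obtain ⟨Γ, hΓ, hdeg⟩ := Apolarity.exists_smoothable_isApolar (K := K) d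
  have hc : Apolarity.cactusRank (∏ i, (MvPolynomial.X i : MvPolynomial (Fin (n + 1)) K) ^ d i) =
      ((∏ i : Fin n, (d i.castSucc + 1) : ℕ) : ℕ∞) :=
    le_antisymm (iInf₂_le_of_le Γ hΓ.2 (by rw [hdeg]))
      (le_iInf₂ fun Γ' h => Nat.cast_le.2 (hlower Γ' h))
  have hs : Apolarity.smoothableRank
      (∏ i, (MvPolynomial.X i : MvPolynomial (Fin (n + 1)) K) ^ d i) =
      ((∏ i : Fin n, (d i.castSucc + 1) : ℕ) : ℕ∞) :=
    le_antisymm (iInf₂_le_of_le Γ hΓ (by rw [hdeg]))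
      (le_iInf₂ fun Γ' h => Nat.cast_le.2 (hlower Γ' h.2))
  refine ⟨Apolarity.annihilator_prod_X_pow d, hc, hs, fun e he => ?_⟩
  obtain rfl : d = fun _ => e := funext he
  have hprod : ∏ _i : Fin n, (e + 1) = (e + 1) ^ n := by simp
  rw [hprod] at hc hs
  refine ⟨?_, hc, hs⟩
  obtain ⟨Γ', hΓ', hdeg'⟩ := Apolarity.exists_smooth_isApolar (K := K) n e
  exact le_antisymm (iInf₂_le_of_le Γ' hΓ' (by rw [hdeg']))
    (le_iInf₂ fun Γ'' h => Nat.cast_le.2 (hprod ▸ hlower Γ'' h.2))
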